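/- Let $0<\mu\le\mu_{\mathrm{upper}}$, $0<\alpha\le\alpha_{\mathrm{upper}}<1$, $0<\gamma\le\tfrac12$ and $\varepsilon>0$. Consider the stationary Hawkes process (started at $-\infty$) with intensity $\lambda^*_t=\mu+\sum_{t_i<t}\alpha e^{-(t-t_i)}$, in its immigration–birth representation: immigrants form a Poisson process of rate $\mu$ on $\mathbb R$, and each event independently produces children according to a Poisson process of intensity $\alpha e^{-u}$, $u>0$, after it. A cluster is the set of all events descending from one immigrant (including it). Let $S(T)$ be the labelled sequence of events observed in $(0,T]$, where $T=K\Delta$ with an integer $K\ge2$, and assume $$\Delta>\frac{10\,\alpha^2}{2(1-\alpha)},\qquad T>1,\qquad T\ge\Big(\frac{\mu e^2}{\gamma}\Big)^{5/2}.$$ For an observed event $j$ let $S_{-j}(T)$ be $S(T)$ with all events of the cluster of $j$ removed. A randomized mechanism $\mathfrak M$ is $(\gamma',\varepsilon')$-randomly differentially private if, with probability at least $1-\gamma'$ over the realization $S(T)$, for every observed event $j$ and every measurable set $C$ of outputs, $$\mathbb P(\mathfrak M(S(T))\in C)\le e^{\varepsilon'}\,\mathbb P(\mathfrak M(S_{-j}(T))\in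 C)\quad\text{and}\quad \mathbb P(\mathfrak M(S_{-j}(T))\in C)\le e^{\varepsilon'}\,\mathbb P(\mathfrak M(S(T))\in C),$$ the inner probabilities being over the randomness of the mechanism only. Let $Y_i$ be the number of observed events in $((i-1)\Delta,i\Delta]$, $1\le i\le K$, let $\hat\eta=\frac1K\sum_i Y_i$ and $\hat\sigma^2=\frac1{K-1}\sum_i(Y_i-\hat\eta)^2$, and put $C_1=\sqrt{\frac{1.1\,\mu_{\mathrm{upper}}}{(1-\alpha_{\mathrm{upper}})^3}\cdot\frac1\gamma}$, $C_2=\frac{3}{(1-\alpha_{\mathrm{upper}})^2}$. With independent centred Laplace variables $\Lambda(b)$ of scale $b$ define $$\hat\eta_{\mathrm{private}}=\hat\eta+\Lambda\Big(\frac{C_2\log T}{K\varepsilon}\Big),\qquad \hat\sigma^2_{\mathrm{private}}=\hat\sigma^2+\Lambda\Big(\frac{C_2^2(\log T)^2+2C_2^{3/2}C_1\frac{K}{K-1}(\log T)^{3/2}\sqrt\Delta}{K\varepsilon}\Big).$$ Then: 1. $\hat\eta_{\mathrm{private}}$ is $(2\gamma,\varepsilon)$-randomly differentially private. 2. $\hat\sigma^2_{\mathrm{private}}$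 is $(2\gamma,\varepsilon)$-randomly differentially private. 3. Let $(\hat\mu_{\mathrm{private}},\hat\alpha_{\mathrm{private}})$ be obtained from $(\hat\eta_{\mathrm{private}},\hat\sigma^2_{\mathrm{private}})$ by any measurable map that, whenever the moment equations $$\hat\eta_{\mathrm{private}}=\frac{m\Delta}{1-a},\qquad \hat\sigma^2_{\mathrm{private}}=\frac{m\Delta}{(1-a)^3}+\frac{a^2m\,(1-e^{-2(1-a)\Delta})}{2(1-a)^4}-\frac{2am\,(1-e^{-(1-a)\Delta})}{(1-a)^4}$$ have a solution $(m,a)$ with $m>0$, $0<a<1$, returns such a solution (its values elsewhere being arbitrary). Then $(\hat\mu_{\mathrm{private}},\hat\alpha_{\mathrm{private}})$, as a joint output, is $(2\gamma,2\varepsilon)$-randomly differentially private. -/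

import Mathlib

open MeasureTheory ProbabilityTheory

noncomputable section

namespace HawkesDP

/-! ### The stationary Hawkes process, in its immigration-birth representation -/

/-- Genealogical labels. `(n, k, [])` is the `k`-th immigrant arriving in the time block
`[n, n + 1]`, and `(n, k, j :: p)` is the `j`-th child of `(n, k, p)`. -/
abbrev Label : Type := ℤ × ℕ × List ℕ

/-- An event `(x, t)`: the identity `x` of the individual and the time stamp `t`. -/
abbrev Event : Type := Label × ℝ

/-- The primitive randomness: the number of immigrants in each block `[n, n + 1]`, the position of
the `k`-th immigrant inside its block, the number of children of each individual, and the delay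
between the birth of the parent of an individual and its own birth. -/
abbrev Source : Type :=
  (ℤ → ℕ) × (ℤ × ℕ → unitInterval) × (Label → ℕ) × (Label → ℝ)

/-- All primitive variables are independent. Poisson(`μ`) many uniform points in each unit block
form a Poisson process of rate `μ` on the whole line; Poisson(`α`) many children with independent
Exp(1) delays form a Poisson process of intensity `α * exp (-u)`, `u > 0`, after the parent. -/
def sourceLaw (μ α : ℝ) : Measure Source :=
  (Measure.infinitePi fun _ : ℤ => poissonMeasure μ.toNNReal).prod
    ((Measure.infinitePi fun _ : ℤ × ℕ => (volume : Measure unitInterval)).prod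
      ((Measure.infinitePi fun _ : Label => poissonMeasure α.toNNReal).prod
        (Measure.infinitePi fun _ : Label => expMeasure 1)))

/-- The individual with the given label is really born. -/
def IsBorn (ω : Source) (n : ℤ) (k : ℕ) : List ℕ → Prop
  | [] => k < ω.1 n
  | j :: p => IsBorn ω n k p ∧ j < ω.2.2.1 (n, k, p)

/-- The time of the event of the individual with the given label. -/
def birthTime (ω : Source) (n : ℤ) (k : ℕ) : List ℕ → ℝ
  | [] => (n : ℝ) + (ω.2.1 (n, k) : ℝ)
  | j :: p => birthTime ω n k p + ω.2.2.2 (n, k, j :: p)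

/-- The events of the Hawkes process (started at time `-∞`) observed during `(0, T]`. -/
def observed (T : ℝ) (ω : Source) : Set Event :=
  {e | IsBorn ω e.1.1 e.1.2.1 e.1.2.2 ∧ e.2 = birthTime ω e.1.1 e.1.2.1 e.1.2.2 ∧
    0 < e.2 ∧ e.2 ≤ T}

/-- Two events belong to the same cluster (tree of parent-child relations) iff they descend from
the same immigrant. -/
def SameCluster (e e' : Event) : Prop :=
  e.1.1 = e'.1.1 ∧ e.1.2.1 = e'.1.2.1

/-- `S` without all events of the cluster of `e`. -/
def removeCluster (S : Set Event) (e : Event) : Set Event :=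
  {e' ∈ S | ¬ SameCluster e e'}

/-! ### Random differential privacy -/

/-- `exp ε`-indistinguishability of two output laws, in both directions. -/
def Indistinguishable {Y : Type*} [MeasurableSpace Y] (ε : ℝ) (ν ν' : Measure Y) : Prop :=
  ∀ C : Set Y, MeasurableSet C →
    ν C ≤ ENNReal.ofReal (Real.exp ε) * ν' C ∧ ν' C ≤ ENNReal.ofReal (Real.exp ε) * ν C

/-- `(γ, ε)`-random differential privacy of the randomized mechanism `M` (which sends a sequence of
events to the law of its output) for the random sequence of events `S`: outside a set of
realizations of probability at most `γ`, the output laws on `S` and on each of its neighbours (`S`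
without the cluster of one of its events) are indistinguishable. -/
def IsRandomlyDP {Ω Y : Type*} [MeasurableSpace Ω] [MeasurableSpace Y] (P : Measure Ω)
    (S : Ω → Set Event) (M : Set Event → Measure Y) (γ ε : ℝ) : Prop :=
  P {ω | ¬ ∀ e ∈ S ω, Indistinguishable ε (M (S ω)) (M (removeCluster (S ω) e))} ≤
    ENNReal.ofReal γ

/-! ### Sample moments and their noisy versions -/

/-- The number of events in bin `i`, that is in `(i * Δ, (i + 1) * Δ]`. -/
def binCount (Δ : ℝ) (S : Set Event) (i : ℕ) : ℝ :=
  ({e ∈ S | (i : ℝ) * Δ < e.2 ∧ e.2 ≤ ((i : ℝ) + 1) * Δ}.ncard : ℝ)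

def sampleMean (K : ℕ) (Δ : ℝ) (S : Set Event) : ℝ :=
  (∑ i ∈ Finset.range K, binCount Δ S i) / K

def sampleVar (K : ℕ) (Δ : ℝ) (S : Set Event) : ℝ :=
  (∑ i ∈ Finset.range K, (binCount Δ S i - sampleMean K Δ S) ^ 2) / ((K : ℝ) - 1)

/-- The Laplace distribution with mean `m` and scale `b`. -/
def laplace (m b : ℝ) : Measure ℝ :=
  volume.withDensity fun x => ENNReal.ofReal (Real.exp (-|x - m| / b) / (2 * b))

def C₁ (μup αup γ : ℝ) : ℝ := Real.sqrt (1.1 * μup / (1 - αup) ^ 3 * (1 / γ))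

def C₂ (αup : ℝ) : ℝ := 3 / (1 - αup) ^ 2

def meanScale (αup ε : ℝ) (K : ℕ) (T : ℝ) : ℝ :=
  C₂ αup * Real.log T / (K * ε)

def varScale (μup αup γ ε : ℝ) (K : ℕ) (Δ T : ℝ) : ℝ :=
  (C₂ αup ^ 2 * Real.log T ^ 2 +
      2 * C₂ αup ^ (3 / 2 : ℝ) * C₁ μup αup γ * ((K : ℝ) / ((K : ℝ) - 1)) *
        Real.log T ^ (3 / 2 : ℝ) * Real.sqrt Δ) / (K * ε)

/-- The noisy sample mean, observation period `T = K * Δ`. -/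
def privateMean (αup ε : ℝ) (K : ℕ) (Δ : ℝ) (S : Set Event) : Measure ℝ :=
  laplace (sampleMean K Δ S) (meanScale αup ε K (K * Δ))

/-- The noisy sample variance, observation period `T = K * Δ`. -/
def privateVar (μup αup γ ε : ℝ) (K : ℕ) (Δ : ℝ) (S : Set Event) : Measure ℝ :=
  laplace (sampleVar K Δ S) (varScale μup αup γ ε K Δ (K * Δ))

/-! ### Estimation of the parameters -/

/-- The moment equations in the unknowns `(μ, α)`, for given mean `η` and variance `v`. -/
def MomentEquations (Δ η v μ α : ℝ) : Prop :=
  η = μ * Δ / (1 - α) ∧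
  v = μ * Δ / (1 - α) ^ 3
      + α ^ 2 * μ * (1 - Real.exp (-2 * (1 - α) * Δ)) / (2 * (1 - α) ^ 4)
      - 2 * α * μ * (1 - Real.exp (-(1 - α) * Δ)) / (1 - α) ^ 4

/-- `solve` returns a solution `(μ, α)` with `μ > 0`, `0 < α < 1` of the moment equations whenever
there is one; the noisy moments may admit none, and then the value is not restricted. -/
def SolvesMomentEquations (Δ : ℝ) (solve : ℝ × ℝ → ℝ × ℝ) : Prop :=
  ∀ η v : ℝ, (∃ μ α : ℝ, 0 < μ ∧ 0 < α ∧ α < 1 ∧ MomentEquations Δ η v μ α) →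
    0 < (solve (η, v)).1 ∧ 0 < (solve (η, v)).2 ∧ (solve (η, v)).2 < 1 ∧
      MomentEquations Δ η v (solve (η, v)).1 (solve (η, v)).2

/-- The law of the private estimates of `(μ, α)`: the moment equations are solved with the noisy
mean and the noisy variance, whose noises are independent. -/
def privateEstimates (μup αup γ ε : ℝ) (K : ℕ) (Δ : ℝ) (solve : ℝ × ℝ → ℝ × ℝ)
    (S : Set Event) : Measure (ℝ × ℝ) :=
  ((privateMean αup ε K Δ S).prod (privateVar μup αup γ ε K Δ S)).map solve

end HawkesDP

end

noncomputable section

open Filter Topology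
open scoped ENNReal NNReal

namespace HawkesDP

/-! ### Products of independent blocks -/

/-! Laplace noise of scale b makes two values at distance at most bε indistinguishable
(`laplace_le`), so everything rests on `measure_sensitivity_le`: off a set of probability 2γ,
deleting any observed cluster moves the sample mean by at most n/K and the sample variance by at
most (n² + 2ns·K/(K-1))/K, with n = C₂ log T and s = √n·C₁·√Δ. These bounds are exactly ε times the
two noise scales. The joint estimate is a function of two independent noisy moments, and both
sensitivities hold off the same exceptional set, so ε doubles while 2γ stays.

Deterministic part. If the cluster puts d_j events in bin j, N in all, and the other clusters put
R_j there, the mean moves by N/K and the variance by (∑d_j² - N²/K)/(K-1) + 2NZ/K. Here Z is the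
d-weighted average over j of the contrast "R_j minus the mean of R over the other bins". By
`abs_variance_sub_le` it is enough that N ≤ n and N ± Z ≤ n + s. Controlling N and Z through these
joint sums, not separately, is what makes the stated scales sufficient.

Probabilistic part. Each condition fails only on an event "some observed cluster has θN + κZ ≥ t"
with κ = 0 or κ = ±θ (`eventually_measure_tailEvent_le`). Markov's inequality, Jensen for the
average Z and the Mecke formula `lintegral_sum_mul_prod_cluster` split the bound into two factors.
(a) The selected cluster contributes μ times the expected sum of exp(θN) over observed positions.
Integrating out position and delays leaves T·E[exp(θN)] + E[(N-1)exp(θN)] for the Galton-Watson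
progeny N. (b) The other clusters contribute the exponential of μ∑(E exp(κ·contrast) - 1). The
linear term sums to zero because all bins have the same mean, and the remainder is bounded by E
exp(|κ|N) - 1 - |κ|E N. The exponential moments come from the inequality exp(θ + α(G-1)) ≤ G, solved
by G = 1 + x, θ = x(1-α) - x²/2. The numerical lemmas choose x so that each tail event costs at most
7γ/12.

The infinite past is handled with a finite set `I` of unit blocks: clusters from outside are
unobserved up to probability γ/4, and the limits along `I` leave the small slack that the constants
absorb. -/

/-- Grouping the coordinates of a product measure by the value of `key` gives independent
families. -/
lemma iIndepFun_fiber {ι κ X : Type*} [MeasurableSpace X] (P : Measure X) [IsProbabilityMeasure P]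
    (key : ι → κ) :
    iIndepFun (fun (k : κ) (ω : ι → X) (i : {i : ι // key i = k}) => ω i)
      (Measure.infinitePi fun _ : ι => P) := by
  rw [iIndepFun_iff_map_fun_eq_infinitePi_map (by fun_prop)]
  have h1 := Measure.map_infinitePi_infinitePi_of_inj (P := fun _ : ι => P)
    (f := fun p : (k : κ) × {i : ι // key i = k} => (p.2 : ι))
    (by
      rintro ⟨k, i, rfl⟩ ⟨k', i', rfl⟩ h
      obtain rfl : i = i' := h
      rfl)
  have h2 := Measure.infinitePi_map_piCurry (fun (k : κ) (_ : {i : ι // key i = k}) => P)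
  have h3 : ∀ k : κ, (Measure.infinitePi fun _ : ι => P).map
      (fun ω (i : {i : ι // key i = k}) => ω i) = Measure.infinitePi fun _ => P := fun k =>
    Measure.map_infinitePi_infinitePi_of_inj (P := fun _ : ι => P) Subtype.val_injective
  simp_rw [h3]
  rw [← h2, ← h1, Measure.map_map (by fun_prop) (by fun_prop)]
  rfl

/-- The common core of all Mecke-type computations below. Independence enters only as factorwise
integration `hV`, a form that passes easily to pairs on product spaces and to blocks of coordinates.
-/
lemma lintegral_sum_mul_prod_erase {Ω ι α : Type*} [MeasurableSpace Ω] [MeasurableSpace α]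
    [DecidableEq ι] {P : Measure Ω} {ν : Measure α} {A : Finset ι} {V : ι → Ω → α}
    (mV : ∀ a, Measurable (V a))
    (hV : ∀ h : ι → α → ℝ≥0∞, (∀ i, Measurable (h i)) →
      ∫⁻ ω, ∏ i ∈ A, h i (V i ω) ∂P = ∏ i ∈ A, ∫⁻ x, h i x ∂ν)
    {f g : ι → α → ℝ≥0∞} (hf : ∀ a, Measurable (f a)) (hg : ∀ a, Measurable (g a)) :
    ∫⁻ ω, ∑ a ∈ A, f a (V a ω) * ∏ b ∈ A.erase a, g b (V b ω) ∂P =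
      ∑ a ∈ A, (∫⁻ x, f a x ∂ν) * ∏ b ∈ A.erase a, ∫⁻ x, g b x ∂ν := by
  have key : ∀ a ∈ A, ∀ F G : ι → ℝ≥0∞, F a * ∏ b ∈ A.erase a, G b =
      ∏ b ∈ A, (if b = a then F b else G b) := by
    intro a ha F G
    rw [← Finset.mul_prod_erase A _ ha, if_pos rfl]
    congr 1
    exact Finset.prod_congr rfl fun b hb => (if_neg (Finset.ne_of_mem_erase hb)).symm
  rw [lintegral_finsetSum' _ fun a _ => Measurable.aemeasurable (by fun_prop)]
  refine Finset.sum_congr rfl fun a ha => ?_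
  simp_rw [fun ω => key a ha (fun b => f b (V b ω)) (fun b => g b (V b ω))]
  rw [key a ha (fun b => ∫⁻ x, f b x ∂ν)]
  have h1 := hV (fun b => if b = a then f b else g b) (fun b => by split_ifs <;> simp [hf, hg])
  simp only [ite_apply] at h1
  rw [h1]
  refine Finset.prod_congr rfl fun b _ => ?_
  split_ifs <;> rfl

/-- If two random families integrate products of functions of single members factorwise, so does
the family of pairs on the product space. -/
lemma lintegral_prod_pair {Ω Ω' ι α β : Type*} [MeasurableSpace Ω] [MeasurableSpace Ω']
    [MeasurableSpace α] [MeasurableSpace β]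
    {P : Measure Ω} {Q : Measure Ω'} [IsProbabilityMeasure P] [IsProbabilityMeasure Q]
    {μ : Measure α} {ν : Measure β} [IsProbabilityMeasure μ] [IsProbabilityMeasure ν]
    {X : ι → Ω → α} {Y : ι → Ω' → β} (mX : ∀ i, Measurable (X i)) (mY : ∀ i, Measurable (Y i))
    (hX : ∀ (A : Finset ι) (h : ι → α → ℝ≥0∞), (∀ i, Measurable (h i)) →
      ∫⁻ ω, ∏ i ∈ A, h i (X i ω) ∂P = ∏ i ∈ A, ∫⁻ x, h i x ∂μ)
    (hY : ∀ (A : Finset ι) (h : ι → β → ℝ≥0∞), (∀ i, Measurable (h i)) →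
      ∫⁻ ω, ∏ i ∈ A, h i (Y i ω) ∂Q = ∏ i ∈ A, ∫⁻ x, h i x ∂ν)
    (A : Finset ι) (h : ι → α × β → ℝ≥0∞) (mh : ∀ i, Measurable (h i)) :
    ∫⁻ ω, ∏ i ∈ A, h i (X i ω.1, Y i ω.2) ∂(P.prod Q) = ∏ i ∈ A, ∫⁻ x, h i x ∂(μ.prod ν) := by
  rw [lintegral_prod _ (by fun_prop)]
  have h1 : ∀ ω, ∫⁻ ω', ∏ i ∈ A, h i (X i ω, Y i ω') ∂Q =
      ∏ i ∈ A, ∫⁻ y, h i (X i ω, y) ∂ν := fun ω =>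
    hY A (fun i y => h i (X i ω, y)) fun i => by fun_prop
  simp_rw [h1]
  rw [hX A (fun i x => ∫⁻ y, h i (x, y) ∂ν) fun i => (mh i).lintegral_prod_right']
  exact Finset.prod_congr rfl fun i _ => (lintegral_prod _ (mh i).aemeasurable).symm

lemma lintegral_prod_infinitePi {ι α : Type*} [MeasurableSpace α] (μ : Measure α)
    [IsProbabilityMeasure μ] (A : Finset ι) (h : ι → α → ℝ≥0∞) (mh : ∀ i, Measurable (h i)) :
    ∫⁻ ω, ∏ i ∈ A, h i (ω i) ∂(Measure.infinitePi fun _ : ι => μ) = ∏ i ∈ A, ∫⁻ x, h i x ∂μ := by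
  rw [lintegral_prod_eq_prod_lintegral_of_indepFun A (fun i (ω : ι → α) => h i (ω i))
    (iIndepFun_infinitePi mh) fun i => by fun_prop]
  refine Finset.prod_congr rfl fun i _ => ?_
  conv_rhs => rw [← Measure.infinitePi_map_eval (fun _ : ι => μ) i]
  rw [lintegral_map (mh i) (by fun_prop)]

/-- The blocks `f (a.1, a.2, ·)` of an i.i.d. family are i.i.d. -/
lemma lintegral_prod_infinitePi_block {ι κ τ X : Type*} [MeasurableSpace X] (P : Measure X)
    [IsProbabilityMeasure P] (A : Finset (ι × κ)) (h : ι × κ → (τ → X) → ℝ≥0∞)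
    (mh : ∀ i, Measurable (h i)) :
    ∫⁻ ω, ∏ a ∈ A, h a (fun q => ω (a.1, a.2, q)) ∂(Measure.infinitePi fun _ : ι × κ × τ => P) =
      ∏ a ∈ A, ∫⁻ x, h a x ∂(Measure.infinitePi fun _ : τ => P) := by
  rw [lintegral_prod_eq_prod_lintegral_of_indepFun A
    (fun a (ω : ι × κ × τ → X) => h a (fun q => ω (a.1, a.2, q)))]
  · refine Finset.prod_congr rfl fun a _ => ?_
    have := Measure.map_infinitePi_infinitePi_of_inj (P := fun _ : ι × κ × τ => P)
      (f := fun q : τ => (a.1, a.2, q)) (fun q q' hq => by simpa using hq)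
    rw [← this, lintegral_map (mh a) (by fun_prop)]
  · have := (iIndepFun_fiber P (fun l : ι × κ × τ => (l.1, l.2.1))).comp
      (g := fun a ω => h a (fun q => ω ⟨(a.1, a.2, q), rfl⟩))
      (fun a => (mh a).comp (by fun_prop))
    exact this
  · intro a
    exact (mh a).comp (by fun_prop)

/-! ### Poisson and exponential integrals -/

lemma lintegral_poissonMeasure (r : ℝ≥0) (f : ℕ → ℝ≥0∞) :
    ∫⁻ n, f n ∂(poissonMeasure r) =
      ∑' n : ℕ, ENNReal.ofReal (Real.exp (-r) * r ^ n / n.factorial) * f n := by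
  rw [poissonMeasure, lintegral_sum_measure]
  refine tsum_congr fun n => ?_
  rw [lintegral_smul_measure, lintegral_dirac, smul_eq_mul]

lemma lintegral_pow_poissonMeasure (r u : ℝ≥0) :
    ∫⁻ n, (u : ℝ≥0∞) ^ n ∂(poissonMeasure r) = ENNReal.ofReal (Real.exp (r * (u - 1))) := by
  rw [lintegral_poissonMeasure]
  have h := (NormedSpace.expSeries_div_hasSum_exp (𝔸 := ℝ) ((r : ℝ) * u)).mul_left (Real.exp (-r))
  rw [← Real.exp_eq_exp_ℝ, ← Real.exp_add] at h
  rw [show (r : ℝ) * (u - 1) = -r + r * u by ring, ← h.tsum_eq,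
    ENNReal.ofReal_tsum_of_nonneg (fun n => by positivity) h.summable]
  refine tsum_congr fun n => ?_
  rw [← ENNReal.ofReal_coe_nnreal, ← ENNReal.ofReal_pow (by positivity),
    ← ENNReal.ofReal_mul (by positivity)]
  congr 1
  rw [mul_pow]
  ring

/-- Derivative in u of the generating function exp(r(u-1)). The truncated n - 1 is harmless, since
the term n = 0 carries the factor 0. -/
lemma lintegral_mul_pow_poissonMeasure (r u : ℝ≥0) :
    ∫⁻ n, (n : ℝ≥0∞) * (u : ℝ≥0∞) ^ (n - 1) ∂(poissonMeasure r) =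
      r * ENNReal.ofReal (Real.exp (r * (u - 1))) := by
  rw [← lintegral_pow_poissonMeasure, lintegral_poissonMeasure, lintegral_poissonMeasure,
    tsum_eq_zero_add' ENNReal.summable, ← ENNReal.tsum_mul_left]
  simp only [Nat.cast_zero, zero_mul, mul_zero, zero_add, Nat.add_sub_cancel]
  refine tsum_congr fun n => ?_
  rw [← mul_assoc, ← mul_assoc, ← ENNReal.ofReal_coe_nnreal (p := r), ← ENNReal.ofReal_natCast,
    ← ENNReal.ofReal_mul (by positivity), ← ENNReal.ofReal_mul (by positivity)]
  congr 2
  rw [Nat.factorial_succ]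
  push_cast
  field_simp
  ring

instance : IsProbabilityMeasure (expMeasure 1) := isProbabilityMeasure_expMeasure one_pos

lemma lintegral_ofReal_expMeasure : ∫⁻ x, ENNReal.ofReal x ∂(expMeasure 1) = 1 := by
  rw [expMeasure, gammaMeasure, lintegral_withDensity_eq_lintegral_mul _ (by
    unfold gammaPDF; exact (measurable_gammaPDFReal 1 1).ennreal_ofReal) (by fun_prop),
    ← lintegral_gammaPDF_eq_one (a := 2) (r := 1) two_pos one_pos]
  refine lintegral_congr fun x => ?_
  rcases lt_or_ge x 0 with hx | hx
  · simp [gammaPDF_of_neg hx]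
  · rw [Pi.mul_apply, gammaPDF_of_nonneg hx, gammaPDF_of_nonneg hx, ← ENNReal.ofReal_mul
      (by have := Real.Gamma_one; positivity)]
    congr 1
    have : Real.Gamma 2 = 1 := Real.Gamma_two
    rw [this, Real.Gamma_one, show (2 : ℝ) - 1 = 1 by norm_num]
    simp
    ring

/-! ### Integrals over the line as sums over unit blocks -/

/-- Turns uniform positions within blocks into Lebesgue measure on the line, which is where
stationarity comes from. -/
lemma tsum_lintegral_unitInterval (f : ℝ → ℝ≥0∞) (hf : Measurable f) :
    ∑' m : ℤ, ∫⁻ u : unitInterval, f (m + u) = ∫⁻ x, f x := by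
  have h1 : ∀ m : ℤ, ∫⁻ u : unitInterval, f (m + u) =
      ∫⁻ x in Set.Ioc (m : ℝ) (m + 1), f x := by
    intro m
    have e : ∫⁻ u : unitInterval, f (m + u) = ∫⁻ x in Set.Icc (0 : ℝ) 1, f (m + x) :=
      lintegral_subtype_comap (μ := volume) measurableSet_Icc (fun x => f (m + x))
    rw [e, setLIntegral_congr Ioc_ae_eq_Icc.symm]
    have := (measurePreserving_add_left (volume : Measure ℝ) (m : ℝ)).setLIntegral_comp_preimage
      (s := Set.Ioc (m : ℝ) (m + 1)) measurableSet_Ioc hf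
    rw [← this]
    simp
  simp_rw [h1]
  rw [← lintegral_iUnion (fun m => measurableSet_Ioc) (Set.pairwise_disjoint_Ioc_intCast ℝ),
    iUnion_Ioc_intCast, Measure.restrict_univ]

/-! ### Galton-Watson trees with Poisson offspring -/

/-- The individual `p` of the tree with offspring numbers `c` is born. -/
def Alive (c : List ℕ → ℕ) : List ℕ → Prop
  | [] => True
  | j :: p => Alive c p ∧ j < c p

/-- Offspring numbers of the subtree of the `j`-th child of the root. -/
def subtree (c : List ℕ → ℕ) (j : ℕ) : List ℕ → ℕ := fun q => c (q ++ [j])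

lemma alive_append (c : List ℕ → ℕ) (j : ℕ) (q : List ℕ) :
    Alive c (q ++ [j]) ↔ j < c [] ∧ Alive (subtree c j) q := by
  induction q with
  | nil => simp [Alive]
  | cons i q ih => simp [Alive, ih, subtree, and_assoc]

lemma measurableSet_alive (p : List ℕ) : MeasurableSet {c | Alive c p} := by
  induction p with
  | nil => simp [Alive]
  | cons j p ih =>
    exact ih.inter (measurableSet_lt measurable_const (measurable_pi_apply p))

@[fun_prop]
lemma measurable_subtree (j : ℕ) : Measurable fun c => subtree c j := by
  unfold subtree; fun_prop

/-- The law of the offspring numbers. -/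
def offspringLaw (r : ℝ≥0) : Measure (List ℕ → ℕ) :=
  Measure.infinitePi fun _ : List ℕ => poissonMeasure r

instance (r : ℝ≥0) : IsProbabilityMeasure (offspringLaw r) := by
  unfold offspringLaw; infer_instance

/-- A label carries the most recent birth at its head, so the child of the root through which a line
of descent passes is the last entry. Decomposing a tree at the root therefore peels lists from the
end. -/
lemma tsum_list_append (f : List ℕ → ℝ≥0∞) :
    ∑' p, f p = f [] + ∑' j, ∑' q, f (q ++ [j]) := by
  rw [ENNReal.tsum_eq_add_tsum_ite [], ← ENNReal.tsum_prod]
  congr 1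
  have hinj : Function.Injective fun x : ℕ × List ℕ => x.2 ++ [x.1] := by
    rintro ⟨j, q⟩ ⟨j', q'⟩ h
    have := List.append_inj' h rfl
    simp_all
  rw [← hinj.tsum_eq]
  · simp
  · intro p hp
    rcases List.eq_nil_or_concat p with rfl | ⟨q, j, rfl⟩
    · simp at hp
    · exact ⟨(j, q), by simp⟩

open scoped Classical in
/-- The sum over the born individuals of a weight that depends on the generation. -/
def weightedSize (w : ℕ → ℝ≥0∞) (c : List ℕ → ℕ) : ℝ≥0∞ :=
  ∑' p, if Alive c p then w p.length else 0

lemma weightedSize_eq (w : ℕ → ℝ≥0∞) (c : List ℕ → ℕ) :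
    weightedSize w c =
      w 0 + ∑ j ∈ Finset.range (c []), weightedSize (fun l => w (l + 1)) (subtree c j) := by
  rw [weightedSize, tsum_list_append]
  congr 1
  · simp [Alive]
  · rw [tsum_eq_sum (s := Finset.range (c []))]
    · refine Finset.sum_congr rfl fun j hj => tsum_congr fun q => ?_
      have hj' := Finset.mem_range.1 hj
      have e := alive_append c j q
      simp only [hj', true_and] at e
      by_cases h : Alive (subtree c j) q
      · rw [if_pos h, if_pos (e.2 h)]
        simp
      · rw [if_neg h, if_neg (mt e.1 h)]
    · intro j hj
      rw [Finset.mem_range] at hj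
      simp [alive_append, hj]

@[fun_prop]
lemma measurable_weightedSize (w : ℕ → ℝ≥0∞) : Measurable (weightedSize w) := by
  unfold weightedSize
  exact Measurable.tsum fun p => Measurable.ite (measurableSet_alive p)
    measurable_const measurable_const

/-- The number of individuals that are ever born. -/
def size (c : List ℕ → ℕ) : ℝ≥0∞ := weightedSize (fun _ => 1) c

@[fun_prop]
lemma measurable_size : Measurable size := measurable_weightedSize _

/-- The number of individuals in the first `g` generations. -/
def treeSize : ℕ → (List ℕ → ℕ) → ℕ
  | 0, _ => 0
  | g + 1, c => 1 + ∑ j ∈ Finset.range (c []), treeSize g (subtree c j)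

/-- Links the recursive truncation, suited to induction, with a sum over labels, from which
measurability, monotonicity and the limit are read off. -/
lemma treeSize_eq (g : ℕ) (c : List ℕ → ℕ) :
    (treeSize g c : ℝ≥0∞) = weightedSize (fun l => if l < g then 1 else 0) c := by
  induction g generalizing c with
  | zero => simp [treeSize, weightedSize]
  | succ g ih => rw [weightedSize_eq]; simp [treeSize, ih]

@[fun_prop]
lemma measurable_treeSize (g : ℕ) : Measurable (treeSize g) := by
  have h : ∀ n : ℕ, MeasurableSet {c | treeSize g c = n} := by
    intro n
    have : {c | treeSize g c = n} =
        {c | weightedSize (fun l => if l < g then 1 else 0) c = n} := by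
      ext c
      simp [← treeSize_eq]
    rw [this]
    exact measurableSet_eq_fun (by fun_prop) measurable_const
  exact measurable_to_countable' h

lemma treeSize_le_size (g : ℕ) (c : List ℕ → ℕ) : (treeSize g c : ℝ≥0∞) ≤ size c := by
  rw [treeSize_eq]
  refine ENNReal.tsum_le_tsum fun p => ?_
  dsimp only
  split_ifs <;> simp

lemma treeSize_mono (c : List ℕ → ℕ) : Monotone fun g => treeSize g c := by
  intro g g' h
  have : (treeSize g c : ℝ≥0∞) ≤ treeSize g' c := by
    rw [treeSize_eq, treeSize_eq]
    refine ENNReal.tsum_le_tsum fun p => ?_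
    dsimp only
    split_ifs <;> first | omega | simp
  exact_mod_cast this

lemma iSup_treeSize (c : List ℕ → ℕ) : ⨆ g, (treeSize g c : ℝ≥0∞) = size c := by
  refine le_antisymm (iSup_le fun g => treeSize_le_size g c) ?_
  rw [size, weightedSize, ENNReal.tsum_eq_iSup_sum]
  refine iSup_le fun s => ?_
  refine le_trans ?_ (le_iSup _ (s.sup List.length + 1))
  rw [treeSize_eq]
  refine le_trans (le_of_eq ?_) (ENNReal.sum_le_tsum s)
  refine Finset.sum_congr rfl fun p hp => ?_
  dsimp only
  rw [if_pos (Nat.lt_succ_of_le (Finset.le_sup (f := List.length) hp))]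

lemma tendsto_treeSize (c : List ℕ → ℕ) :
    Tendsto (fun g => (treeSize g c : ℝ≥0∞)) atTop (𝓝 (size c)) := by
  rw [← iSup_treeSize]
  exact tendsto_atTop_iSup fun g g' h => by exact_mod_cast treeSize_mono c h

lemma tendsto_treeSize_real {c : List ℕ → ℕ} (hc : size c ≠ ∞) :
    Tendsto (fun g => (treeSize g c : ℝ)) atTop (𝓝 (size c).toReal) := by
  refine ((ENNReal.tendsto_toReal hc).comp (tendsto_treeSize c)).congr fun g => ?_
  simp

/-- The branching property: the subtrees of the children of the root are independent copies of the
tree, independent of the offspring of the root. -/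
lemma offspringLaw_map_root (r : ℝ≥0) :
    (offspringLaw r).map (fun c => (c [], fun j => subtree c j)) =
      (poissonMeasure r).prod (Measure.infinitePi fun _ : ℕ => offspringLaw r) := by
  have h1 : (offspringLaw r).map (fun c => c []) = poissonMeasure r :=
    Measure.infinitePi_map_eval _ _
  have h2 : (offspringLaw r).map (fun c j => subtree c j) =
      Measure.infinitePi fun _ : ℕ => offspringLaw r := by
    have hinj : Function.Injective fun x : ℕ × List ℕ => x.2 ++ [x.1] := by
      rintro ⟨j, q⟩ ⟨j', q'⟩ h
      have := List.append_inj' h rfl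
      simp_all
    have e1 := Measure.map_infinitePi_infinitePi_of_inj
      (P := fun _ : List ℕ => poissonMeasure r) hinj
    have e2 := Measure.infinitePi_map_curry (fun (_ : ℕ) (_ : List ℕ) => poissonMeasure r)
    unfold offspringLaw
    rw [← e2, ← e1, Measure.map_map (by fun_prop) (by fun_prop)]
    rfl
  have hind : IndepFun (fun c : List ℕ → ℕ => c []) (fun c j => subtree c j)
      (offspringLaw r) := by
    have := (iIndepFun_fiber (poissonMeasure r) (fun l : List ℕ => decide (l = []))).indepFun
      (i := true) (j := false) (by simp)
    have m1 : Measurable fun f : {l : List ℕ // decide (l = []) = true} → ℕ =>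
        f ⟨[], by simp⟩ := measurable_pi_apply _
    have m2 : Measurable fun (f : {l : List ℕ // decide (l = []) = false} → ℕ) (j : ℕ)
        (q : List ℕ) => f ⟨q ++ [j], by simp⟩ := by fun_prop
    exact this.comp m1 m2
  rw [(indepFun_iff_map_prod_eq_prod_map_map (measurable_pi_apply _).aemeasurable
    (Measurable.aemeasurable (by fun_prop))).1 hind, h1, h2]

lemma lintegral_offspringLaw_root (r : ℝ≥0) (F : ℕ → (ℕ → List ℕ → ℕ) → ℝ≥0∞)
    (hF : ∀ n, Measurable (F n)) :
    ∫⁻ c, F (c []) (fun j => subtree c j) ∂(offspringLaw r) =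
      ∫⁻ n, ∫⁻ s, F n s ∂(Measure.infinitePi fun _ : ℕ => offspringLaw r) ∂(poissonMeasure r) := by
  have hm : Measurable fun x : ℕ × (ℕ → List ℕ → ℕ) => F x.1 x.2 :=
    measurable_from_prod_countable_right hF
  rw [← lintegral_prod _ hm.aemeasurable, ← offspringLaw_map_root,
    lintegral_map hm (by fun_prop)]

lemma lintegral_prod_subtree (r U : ℝ≥0) {u : (List ℕ → ℕ) → ℝ≥0∞} (hu : Measurable u)
    (hU : ∫⁻ c, u c ∂(offspringLaw r) = U) :
    ∫⁻ c, ∏ j ∈ Finset.range (c []), u (subtree c j) ∂(offspringLaw r) =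
      ENNReal.ofReal (Real.exp (r * (U - 1))) := by
  rw [lintegral_offspringLaw_root r (fun n s => ∏ j ∈ Finset.range n, u (s j))
    fun n => by fun_prop, ← lintegral_pow_poissonMeasure]
  refine lintegral_congr fun n => ?_
  rw [lintegral_prod_infinitePi _ _ (fun _ => u) fun _ => hu]
  simp [hU]

/-- Mecke formula at the root: one child is singled out and the others enter through the Poisson
generating function. -/
lemma lintegral_sum_mul_prod_subtree (r U : ℝ≥0) {u v : (List ℕ → ℕ) → ℝ≥0∞}
    (hu : Measurable u) (hv : Measurable v) (hU : ∫⁻ c, u c ∂(offspringLaw r) = U) :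
    ∫⁻ c, ∑ j ∈ Finset.range (c []), v (subtree c j) *
        ∏ i ∈ (Finset.range (c [])).erase j, u (subtree c i) ∂(offspringLaw r) =
      (∫⁻ c, v c ∂(offspringLaw r)) * (r * ENNReal.ofReal (Real.exp (r * (U - 1)))) := by
  rw [lintegral_offspringLaw_root r (fun n s => ∑ j ∈ Finset.range n, v (s j) *
    ∏ i ∈ (Finset.range n).erase j, u (s i)) fun n => by fun_prop,
    ← lintegral_mul_pow_poissonMeasure, ← lintegral_const_mul _ (by fun_prop)]
  refine lintegral_congr fun n => ?_
  rw [lintegral_sum_mul_prod_erase (V := fun j (s : ℕ → List ℕ → ℕ) => s j) (f := fun _ => v)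
    (g := fun _ => u) (ν := offspringLaw r) (by fun_prop)
    (fun h mh => lintegral_prod_infinitePi _ _ h mh) (fun _ => hv) (fun _ => hu)]
  rw [Finset.sum_congr rfl fun j hj => by
    rw [Finset.prod_const, Finset.card_erase_of_mem hj, Finset.card_range, hU]]
  rw [Finset.sum_const, Finset.card_range, nsmul_eq_mul]
  ring

lemma lintegral_sum_subtree (r : ℝ≥0) {v : (List ℕ → ℕ) → ℝ≥0∞} (hv : Measurable v) :
    ∫⁻ c, ∑ j ∈ Finset.range (c []), v (subtree c j) ∂(offspringLaw r) =
      r * ∫⁻ c, v c ∂(offspringLaw r) := by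
  have := lintegral_sum_mul_prod_subtree r 1 (u := fun _ => 1) measurable_const hv (by simp)
  simpa [mul_comm] using this

/-! ### Exponential moments of the total progeny -/

lemma lintegral_treeSize_le {r : ℝ≥0} (hr : r < 1) (g : ℕ) :
    ∫⁻ c, (treeSize g c : ℝ≥0∞) ∂(offspringLaw r) ≤ ENNReal.ofReal (1 / (1 - r)) := by
  have h0 : (0 : ℝ) < 1 - r := by
    have : (r : ℝ) < 1 := by exact_mod_cast hr
    linarith
  induction g with
  | zero => simp [treeSize]
  | succ g ih =>
    simp only [treeSize, Nat.cast_add, Nat.cast_one, Nat.cast_sum]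
    rw [lintegral_add_left measurable_const, lintegral_sum_subtree r
      (v := fun c => (treeSize g c : ℝ≥0∞)) (by fun_prop)]
    refine (add_le_add_right (mul_le_mul_right ih _) _).trans (le_of_eq ?_)
    rw [← ENNReal.ofReal_coe_nnreal, ← ENNReal.ofReal_mul (by positivity)]
    simp only [lintegral_const, measure_univ, mul_one]
    rw [← ENNReal.ofReal_one, ← ENNReal.ofReal_add (by norm_num) (by positivity)]
    congr 1
    field_simp
    ring

lemma size_eq (c : List ℕ → ℕ) :
    size c = 1 + ∑ j ∈ Finset.range (c []), size (subtree c j) := weightedSize_eq _ c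

/-- The mean solves x = 1 + r·x. Since ∞ solves it too, finiteness is obtained first, from the
truncated trees by monotone convergence. -/
lemma lintegral_size {r : ℝ≥0} (hr : r < 1) :
    ∫⁻ c, size c ∂(offspringLaw r) = ENNReal.ofReal (1 / (1 - r)) := by
  have h0 : (0 : ℝ) < 1 - r := by
    have : (r : ℝ) < 1 := by exact_mod_cast hr
    linarith
  have hle : ∫⁻ c, size c ∂(offspringLaw r) ≤ ENNReal.ofReal (1 / (1 - r)) := by
    simp_rw [← iSup_treeSize]
    rw [lintegral_iSup (fun g => by fun_prop)
      (fun g g' h c => by dsimp only; exact_mod_cast treeSize_mono c h)]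
    exact iSup_le fun g => lintegral_treeSize_le hr g
  have hfin : ∫⁻ c, size c ∂(offspringLaw r) ≠ ∞ := ne_top_of_le_ne_top (by simp) hle
  have hrec : ∫⁻ c, size c ∂(offspringLaw r) = 1 + r * ∫⁻ c, size c ∂(offspringLaw r) := by
    conv_lhs => rw [lintegral_congr size_eq]
    rw [lintegral_add_left measurable_const, lintegral_sum_subtree r measurable_size]
    simp
  obtain ⟨x, hx⟩ : ∃ x : ℝ≥0, ∫⁻ c, size c ∂(offspringLaw r) = x :=
    ⟨_, (ENNReal.coe_toNNReal hfin).symm⟩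
  rw [hx] at hrec ⊢
  have h1 : (x : ℝ) = 1 + r * x := by exact_mod_cast hrec
  rw [← ENNReal.ofReal_coe_nnreal]
  congr 1
  rw [eq_div_iff h0.ne']
  linarith

lemma ae_size_ne_top {r : ℝ≥0} (hr : r < 1) : ∀ᵐ c ∂(offspringLaw r), size c ≠ ∞ := by
  have : ∫⁻ c, size c ∂(offspringLaw r) ≠ ∞ := by simp [lintegral_size hr]
  filter_upwards [ae_lt_top measurable_size this] with c hc using hc.ne

/-- The exponential weight `exp (θ * N)`. -/
def expWeight (θ x : ℝ) : ℝ≥0∞ := ENNReal.ofReal (Real.exp (θ * x))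

@[fun_prop]
lemma measurable_expWeight (θ : ℝ) : Measurable (expWeight θ) := by
  unfold expWeight; fun_prop

lemma measurable_root {F : ℕ → (List ℕ → ℕ) → ℝ≥0∞} (hF : ∀ n, Measurable (F n)) :
    Measurable fun c : List ℕ → ℕ => F (c []) c :=
  (measurable_from_prod_countable_right (f := fun x : ℕ × (List ℕ → ℕ) => F x.1 x.2) hF).comp
    ((measurable_pi_apply (X := fun _ : List ℕ => ℕ) []).prodMk measurable_id)

lemma expWeight_treeSize_succ (θ : ℝ) (g : ℕ) (c : List ℕ → ℕ) :
    expWeight θ (treeSize (g + 1) c) = ENNReal.ofReal (Real.exp θ) *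
      ∏ j ∈ Finset.range (c []), expWeight θ (treeSize g (subtree c j)) := by
  simp only [expWeight]
  rw [← ENNReal.ofReal_prod_of_nonneg (fun _ _ => by positivity), ← Real.exp_sum,
    ← ENNReal.ofReal_mul (by positivity), ← Real.exp_add]
  simp [treeSize, mul_add, Finset.mul_sum]

/-- The moment of g + 1 generations is exp(θ + r(U-1)), with U the moment of g generations. So any G
≥ 1 with exp(θ + r(G-1)) ≤ G is preserved by the induction. -/
lemma lintegral_expWeight_treeSize_le {r : ℝ≥0} {θ G : ℝ} (hG : 1 ≤ G)
    (h : Real.exp (θ + r * (G - 1)) ≤ G) (g : ℕ) :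
    ∫⁻ c, expWeight θ (treeSize g c) ∂(offspringLaw r) ≤ ENNReal.ofReal G := by
  induction g with
  | zero => simpa [treeSize, expWeight] using hG
  | succ g ih =>
    obtain ⟨U, hU⟩ : ∃ U : ℝ≥0, ∫⁻ c, expWeight θ (treeSize g c) ∂(offspringLaw r) = U :=
      ⟨_, (ENNReal.coe_toNNReal (ne_top_of_le_ne_top (by simp) ih)).symm⟩
    simp_rw [expWeight_treeSize_succ]
    rw [lintegral_const_mul _ (measurable_root
        (F := fun n c => ∏ j ∈ Finset.range n, expWeight θ (treeSize g (subtree c j)))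
        fun n => by fun_prop),
      lintegral_prod_subtree r U (u := fun c => expWeight θ (treeSize g c)) (by fun_prop) hU,
      ← ENNReal.ofReal_mul (by positivity), ← Real.exp_add]
    refine ENNReal.ofReal_le_ofReal (le_trans ?_ h)
    have hUG : (U : ℝ) ≤ G := by
      rw [hU, ← ENNReal.ofReal_coe_nnreal] at ih
      exact (ENNReal.ofReal_le_ofReal_iff (by linarith)).1 ih
    gcongr

/-- With F the moment of N·exp(θN), the root decomposition bounds the moment of (N-1)exp(θN) by
rG·F, and adding that of exp(θN) gives F ≤ rG·F + G along the generations. The two bounds are proved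
together because each step needs the second one for g. -/
lemma lintegral_treeSize_mul_expWeight_le {r : ℝ≥0} {θ G : ℝ} (hG : 1 ≤ G)
    (h : Real.exp (θ + r * (G - 1)) ≤ G) (hrG : r * G < 1) (g : ℕ) :
    ∫⁻ c, ((treeSize g c - 1 : ℕ) : ℝ≥0∞) * expWeight θ (treeSize g c) ∂(offspringLaw r) ≤
        ENNReal.ofReal (r * G ^ 2 / (1 - r * G)) ∧
      ∫⁻ c, (treeSize g c : ℝ≥0∞) * expWeight θ (treeSize g c) ∂(offspringLaw r) ≤
        ENNReal.ofReal (G / (1 - r * G)) := by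
  have h0 : 0 < 1 - r * G := by linarith
  have hG0 : 0 < G := by linarith
  induction g with
  | zero => simp [treeSize]
  | succ g ih =>
    have hle := lintegral_expWeight_treeSize_le hG h g
    obtain ⟨U, hU⟩ : ∃ U : ℝ≥0, ∫⁻ c, expWeight θ (treeSize g c) ∂(offspringLaw r) = U :=
      ⟨_, (ENNReal.coe_toNNReal (ne_top_of_le_ne_top (by simp) hle)).symm⟩
    have hUG : (U : ℝ) ≤ G := by
      rw [hU, ← ENNReal.ofReal_coe_nnreal] at hle
      exact (ENNReal.ofReal_le_ofReal_iff (by linarith)).1 hle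
    have e1 : ∀ c, ((treeSize (g + 1) c - 1 : ℕ) : ℝ≥0∞) * expWeight θ (treeSize (g + 1) c) =
        ENNReal.ofReal (Real.exp θ) * ∑ j ∈ Finset.range (c []),
          (treeSize g (subtree c j) * expWeight θ (treeSize g (subtree c j))) *
          ∏ i ∈ (Finset.range (c [])).erase j, expWeight θ (treeSize g (subtree c i)) := by
      intro c
      rw [expWeight_treeSize_succ, mul_left_comm]
      congr 1
      rw [treeSize, Nat.add_sub_cancel_left, Nat.cast_sum, Finset.sum_mul]
      refine Finset.sum_congr rfl fun j hj => ?_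
      rw [mul_assoc, Finset.mul_prod_erase _ (fun i => expWeight θ (treeSize g (subtree c i))) hj]
    have h1 : ∫⁻ c, ((treeSize (g + 1) c - 1 : ℕ) : ℝ≥0∞) *
        expWeight θ (treeSize (g + 1) c) ∂(offspringLaw r) ≤
        ENNReal.ofReal (r * G ^ 2 / (1 - r * G)) := by
      simp_rw [e1]
      rw [lintegral_const_mul _ (measurable_root (F := fun n c => ∑ j ∈ Finset.range n,
          (treeSize g (subtree c j) * expWeight θ (treeSize g (subtree c j))) *
          ∏ i ∈ (Finset.range n).erase j, expWeight θ (treeSize g (subtree c i)))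
          fun n => by fun_prop),
        lintegral_sum_mul_prod_subtree r U (u := fun c => expWeight θ (treeSize g c))
          (v := fun c => treeSize g c * expWeight θ (treeSize g c)) (by fun_prop)
          (by fun_prop) hU]
      calc _ ≤ ENNReal.ofReal (Real.exp θ) * (ENNReal.ofReal (G / (1 - r * G)) *
            (r * ENNReal.ofReal (Real.exp (r * (U - 1))))) := by gcongr; exact ih.2
        _ = ENNReal.ofReal (Real.exp (θ + r * (U - 1)) * (G / (1 - r * G) * r)) := by
          rw [← ENNReal.ofReal_coe_nnreal (p := r), ← ENNReal.ofReal_mul (by positivity),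
            ← ENNReal.ofReal_mul (by positivity), ← ENNReal.ofReal_mul (by positivity),
            Real.exp_add]
          congr 1
          ring
        _ ≤ _ := by
          refine ENNReal.ofReal_le_ofReal ?_
          have : Real.exp (θ + r * (U - 1)) ≤ G := le_trans (by gcongr) h
          calc _ ≤ G * (G / (1 - r * G) * r) := by gcongr
            _ = _ := by ring
    refine ⟨h1, ?_⟩
    have e2 : ∀ c, (treeSize (g + 1) c : ℝ≥0∞) * expWeight θ (treeSize (g + 1) c) =
        ((treeSize (g + 1) c - 1 : ℕ) : ℝ≥0∞) * expWeight θ (treeSize (g + 1) c) +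
          expWeight θ (treeSize (g + 1) c) := by
      intro c
      rw [treeSize, Nat.add_sub_cancel_left]
      push_cast
      ring
    simp_rw [e2]
    rw [lintegral_add_right _ (by fun_prop)]
    refine (add_le_add h1 (lintegral_expWeight_treeSize_le hG h (g + 1))).trans (le_of_eq ?_)
    rw [← ENNReal.ofReal_add (by positivity) (by positivity)]
    congr 1
    field_simp
    ring

/-- Fatou along the generations. Almost sure finiteness of the tree is needed for `toReal` to be the
true limit. -/
lemma lintegral_expWeight_size_le {r : ℝ≥0} (hr : r < 1) {θ G : ℝ} (hG : 1 ≤ G)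
    (h : Real.exp (θ + r * (G - 1)) ≤ G) :
    ∫⁻ c, expWeight θ (size c).toReal ∂(offspringLaw r) ≤ ENNReal.ofReal G := by
  have hlim : ∀ᵐ c ∂(offspringLaw r), liminf (fun g => expWeight θ (treeSize g c)) atTop =
      expWeight θ (size c).toReal := by
    filter_upwards [ae_size_ne_top hr] with c hc
    refine Tendsto.liminf_eq ?_
    exact ENNReal.tendsto_ofReal (((Real.continuous_exp.tendsto _).comp
      ((tendsto_treeSize_real hc).const_mul θ)))
  rw [← lintegral_congr_ae hlim]
  refine (lintegral_liminf_le fun g => by fun_prop).trans ?_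
  refine (liminf_le_liminf (v := fun _ => ENNReal.ofReal G)
    (Eventually.of_forall fun g => lintegral_expWeight_treeSize_le hG h g)).trans ?_
  simp

lemma lintegral_size_mul_expWeight_le {r : ℝ≥0} (hr : r < 1) {θ G : ℝ} (hG : 1 ≤ G)
    (h : Real.exp (θ + r * (G - 1)) ≤ G) (hrG : r * G < 1) :
    ∫⁻ c, (size c - 1) * expWeight θ (size c).toReal ∂(offspringLaw r) ≤
      ENNReal.ofReal (r * G ^ 2 / (1 - r * G)) := by
  have hlim : ∀ᵐ c ∂(offspringLaw r), liminf
      (fun g => ((treeSize g c - 1 : ℕ) : ℝ≥0∞) * expWeight θ (treeSize g c)) atTop =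
      (size c - 1) * expWeight θ (size c).toReal := by
    filter_upwards [ae_size_ne_top hr] with c hc
    refine Tendsto.liminf_eq ?_
    refine ENNReal.Tendsto.mul ?_ (Or.inr (by simp [expWeight])) ?_ (Or.inr (by simp [hc]))
    · have := ENNReal.Tendsto.sub (tendsto_treeSize c) (tendsto_const_nhds (x := (1 : ℝ≥0∞)))
        (Or.inr (by simp))
      simpa using this
    · exact ENNReal.tendsto_ofReal (((Real.continuous_exp.tendsto _).comp
        ((tendsto_treeSize_real hc).const_mul θ)))
  rw [← lintegral_congr_ae hlim]
  refine (lintegral_liminf_le fun g => by fun_prop).trans ?_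
  refine (liminf_le_liminf (v := fun _ => ENNReal.ofReal (r * G ^ 2 / (1 - r * G)))
    (Eventually.of_forall fun g =>
      (lintegral_treeSize_mul_expWeight_le hG h hrG g).1)).trans ?_
  simp

/-! ### Clusters: trees with birth times -/

/-- Offspring numbers and delays of a cluster. -/
abbrev Tree : Type := (List ℕ → ℕ) × (List ℕ → ℝ)

def treeLaw (r : ℝ≥0) : Measure Tree :=
  (offspringLaw r).prod (Measure.infinitePi fun _ : List ℕ => expMeasure 1)

instance (r : ℝ≥0) : IsProbabilityMeasure (treeLaw r) := by
  unfold treeLaw; infer_instance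

/-- Time between the immigrant and the birth of the individual `p`. -/
def age (δ : List ℕ → ℝ) : List ℕ → ℝ
  | [] => 0
  | j :: p => age δ p + δ (j :: p)

@[fun_prop]
lemma measurable_age (p : List ℕ) : Measurable fun δ => age δ p := by
  induction p with
  | nil => exact measurable_const
  | cons j p ih => exact ih.add (measurable_pi_apply _)

open scoped Classical in
/-- The number of individuals born at a time in `B`, in a cluster with an immigrant at time `x`. -/
def count (B : Set ℝ) (x : ℝ) (y : Tree) : ℝ≥0∞ :=
  ∑' p, if Alive y.1 p ∧ x + age y.2 p ∈ B then 1 else 0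

lemma measurable_count {B : Set ℝ} (hB : MeasurableSet B) :
    Measurable fun z : ℝ × Tree => count B z.1 z.2 := by
  unfold count
  refine Measurable.tsum fun p => Measurable.ite ?_ measurable_const measurable_const
  have h1 : Measurable fun z : ℝ × Tree => z.2.1 := by fun_prop
  have h2 : Measurable fun z : ℝ × Tree => z.1 + age z.2.2 p := by fun_prop
  exact (h1 (measurableSet_alive p)).inter (h2 hB)

lemma count_le_size (B : Set ℝ) (x : ℝ) (y : Tree) : count B x y ≤ size y.1 := by
  refine ENNReal.tsum_le_tsum fun p => ?_
  split_ifs with h1 h2 <;> simp_all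

lemma one_le_size (c : List ℕ → ℕ) : 1 ≤ size c := by
  rw [size_eq]; exact le_self_add

lemma count_biUnion {ι : Type*} (s : Finset ι) (B : ι → Set ℝ)
    (hB : Set.PairwiseDisjoint (s : Set ι) B) (x : ℝ) (y : Tree) :
    count (⋃ i ∈ s, B i) x y = ∑ i ∈ s, count (B i) x y := by
  classical
  unfold count
  rw [← Summable.tsum_finsetSum fun i _ => ENNReal.summable]
  refine tsum_congr fun p => ?_
  by_cases h : Alive y.1 p ∧ x + age y.2 p ∈ ⋃ i ∈ s, B i
  · obtain ⟨h1, h2⟩ := h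
    obtain ⟨i, hi, hx⟩ := Set.mem_iUnion₂.1 h2
    rw [if_pos ⟨h1, h2⟩, Finset.sum_eq_single_of_mem i hi, if_pos ⟨h1, hx⟩]
    intro j hj hji
    rw [if_neg]
    rintro ⟨-, hx'⟩
    exact Set.disjoint_left.1 (hB hj hi hji) hx' hx
  · rw [if_neg h, eq_comm, Finset.sum_eq_zero]
    intro i hi
    rw [if_neg]
    rintro ⟨h1, h2⟩
    exact h ⟨h1, Set.mem_iUnion₂.2 ⟨i, hi, h2⟩⟩

open scoped Classical in
/-- An upper bound for the time between the immigrant and its last descendant. -/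
def life (y : Tree) : ℝ≥0∞ :=
  ∑' p, if p ≠ [] ∧ Alive y.1 p then ENNReal.ofReal (y.2 p) else 0

@[fun_prop]
lemma measurable_life : Measurable life := by
  unfold life
  refine Measurable.tsum fun p => Measurable.ite ?_ (by fun_prop) measurable_const
  by_cases hp : p = []
  · simp [hp]
  · have h1 : Measurable fun y : Tree => y.1 := by fun_prop
    simpa [hp] using h1 (measurableSet_alive p)

open scoped Classical in
lemma ofReal_age_le_life (y : Tree) {p : List ℕ} (hp : Alive y.1 p) :
    ENNReal.ofReal (age y.2 p) ≤ life y := by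
  -- The sum is limited to labels no longer than `p`, so that in the induction step the delay of the
  -- new, longer label has not been counted yet.
  have key : ∀ p : List ℕ, Alive y.1 p → ENNReal.ofReal (age y.2 p) ≤
      ∑' q, if q.length ≤ p.length ∧ q ≠ [] ∧ Alive y.1 q then ENNReal.ofReal (y.2 q) else 0 := by
    intro p
    induction p with
    | nil => simp [age]
    | cons j p ih =>
      intro h
      rw [ENNReal.tsum_eq_add_tsum_ite (j :: p), if_pos ⟨le_rfl, by simp, h⟩, add_comm]
      refine ENNReal.ofReal_add_le.trans (add_le_add_left ((ih h.1).trans ?_) _)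
      refine ENNReal.tsum_le_tsum fun q => ?_
      by_cases hq : q.length ≤ p.length ∧ q ≠ [] ∧ Alive y.1 q
      · have h1 : q ≠ j :: p := by
          rintro rfl
          simp at hq
        rw [if_pos hq, if_neg h1, if_pos ⟨by simp; omega, hq.2⟩]
      · simp [hq]
  refine (key p hp).trans (ENNReal.tsum_le_tsum fun q => ?_)
  split_ifs with h1 h2
  · rfl
  · exact absurd h1.2 h2
  · simp
  · rfl

/-- Given the offspring numbers, each of the N - 1 non-root individuals contributes an independent
delay of mean 1. -/
lemma lintegral_life_mul (r : ℝ≥0) {h : (List ℕ → ℕ) → ℝ≥0∞} (hh : Measurable h) (hr : r < 1) :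
    ∫⁻ y, life y * h y.1 ∂(treeLaw r) = ∫⁻ c, (size c - 1) * h c ∂(offspringLaw r) := by
  classical
  rw [treeLaw, lintegral_prod _ (by fun_prop)]
  refine lintegral_congr_ae ?_
  filter_upwards [ae_size_ne_top hr] with c hc
  rw [lintegral_mul_const _ (by fun_prop)]
  congr 1
  unfold life
  have hm : ∀ p, Measurable fun δ : List ℕ → ℝ =>
      if p ≠ [] ∧ Alive c p then ENNReal.ofReal (δ p) else 0 := fun p =>
    Measurable.ite (MeasurableSet.const _) (by fun_prop) measurable_const
  rw [lintegral_tsum fun p => (hm p).aemeasurable]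
  have h1 : ∀ p, ∫⁻ δ, (if p ≠ [] ∧ Alive c p then ENNReal.ofReal (δ p) else 0)
      ∂(Measure.infinitePi fun _ : List ℕ => expMeasure 1) =
      if p ≠ [] ∧ Alive c p then 1 else 0 := by
    intro p
    split_ifs
    · rw [← lintegral_ofReal_expMeasure]
      conv_rhs => rw [← Measure.infinitePi_map_eval (fun _ : List ℕ => expMeasure 1) p]
      rw [lintegral_map (by fun_prop) (by fun_prop)]
    · simp
  simp_rw [h1]
  have h2 : size c = 1 + ∑' p, if p ≠ [] ∧ Alive c p then 1 else 0 := by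
    rw [size, weightedSize, ENNReal.tsum_eq_add_tsum_ite []]
    congr 1
    · simp [Alive]
    · refine tsum_congr fun p => ?_
      by_cases hp : p = [] <;> simp [hp]
  rw [h2, ENNReal.add_sub_cancel_left (by simp)]

lemma lintegral_count {B : Set ℝ} (hB : MeasurableSet B) (y : Tree) :
    ∫⁻ x, count B x y = volume B * size y.1 := by
  classical
  unfold count
  have hs : ∀ p, MeasurableSet {x : ℝ | x + age y.2 p ∈ B} := fun p =>
    (measurable_id.add_const _) hB
  have hm : ∀ p, Measurable fun x : ℝ =>
      if Alive y.1 p ∧ x + age y.2 p ∈ B then (1 : ℝ≥0∞) else 0 := fun p =>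
    Measurable.ite ((MeasurableSet.const _).inter (hs p)) measurable_const measurable_const
  rw [lintegral_tsum fun p => (hm p).aemeasurable, size, weightedSize, ← ENNReal.tsum_mul_left]
  refine tsum_congr fun p => ?_
  by_cases hp : Alive y.1 p
  · simp only [hp, true_and, if_true, mul_one]
    have : ∀ x : ℝ, (if x + age y.2 p ∈ B then (1 : ℝ≥0∞) else 0) =
      Set.indicator {x : ℝ | x + age y.2 p ∈ B} 1 x := fun x => by
        simp [Set.indicator_apply]
    simp_rw [this]
    rw [lintegral_indicator_one (hs p)]
    exact measure_preimage_add_right volume (age y.2 p) B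
  · simp [hp]

lemma age_nonneg {δ : List ℕ → ℝ} (hδ : ∀ p, 0 ≤ δ p) (p : List ℕ) : 0 ≤ age δ p := by
  induction p with
  | nil => exact le_rfl
  | cons j p ih => exact add_nonneg ih (hδ _)

lemma ae_treeLaw_nonneg (r : ℝ≥0) : ∀ᵐ y ∂(treeLaw r), ∀ p, 0 ≤ y.2 p := by
  have h0 : ∀ᵐ x ∂(expMeasure 1), 0 ≤ x := by
    rw [ae_iff, expMeasure, gammaMeasure, withDensity_apply _ (by measurability)]
    rw [setLIntegral_congr_fun (g := fun _ => 0) (by measurability)]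
    · simp
    · intro x hx
      exact gammaPDF_of_neg (by simpa using hx)
  rw [ae_all_iff]
  intro p
  have e : (treeLaw r).map (fun y => y.2 p) = expMeasure 1 := by
    have : (fun y : Tree => y.2 p) = (fun δ : List ℕ → ℝ => δ p) ∘ Prod.snd := rfl
    rw [this, ← Measure.map_map (by fun_prop) (by fun_prop), treeLaw, Measure.map_snd_prod]
    simp [Measure.infinitePi_map_eval]
  rw [← e] at h0
  exact ae_of_ae_map (Measurable.aemeasurable (by fun_prop)) h0

open scoped Classical in
-- A cluster is seen in (0, T] only if its immigrant arrives in [-life, T]. This is where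
-- nonnegative delays matter.
lemma lintegral_count_ne_zero_le {T : ℝ} {y : Tree} (hy : ∀ p, 0 ≤ y.2 p) :
    ∫⁻ x, (if count (Set.Ioc 0 T) x y ≠ 0 then 1 else 0) ≤ ENNReal.ofReal T + life y := by
  by_cases hl : life y = ∞
  · simp [hl]
  have h1 : ∀ x : ℝ, (if count (Set.Ioc 0 T) x y ≠ 0 then (1 : ℝ≥0∞) else 0) ≤
      Set.indicator (Set.Icc (-(life y).toReal) T) 1 x := by
    intro x
    split_ifs with h
    · obtain ⟨p, hp⟩ : ∃ p, Alive y.1 p ∧ x + age y.2 p ∈ Set.Ioc 0 T := by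
        by_contra! hne
        exact h (ENNReal.tsum_eq_zero.2 fun p => if_neg fun hp => hne p hp.1 hp.2)
      have h2 := (ENNReal.ofReal_le_iff_le_toReal hl).1 (ofReal_age_le_life y hp.1)
      have h3 := age_nonneg hy p
      have h4 := hp.2.1
      have h5 := hp.2.2
      rw [Set.indicator_of_mem (by constructor <;> linarith)]
      rfl
    · simp
  refine (lintegral_mono h1).trans ?_
  rw [lintegral_indicator_one measurableSet_Icc, Real.volume_Icc, sub_neg_eq_add]
  exact ENNReal.ofReal_add_le.trans (by rw [ENNReal.ofReal_toReal hl])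

/-- A cluster: position of the immigrant in its block, offspring numbers and delays. -/
abbrev Cluster : Type := unitInterval × Tree

def clusterLaw (r : ℝ≥0) : Measure Cluster := (volume : Measure unitInterval).prod (treeLaw r)

instance (r : ℝ≥0) : IsProbabilityMeasure (clusterLaw r) := by
  unfold clusterLaw; infer_instance

lemma tsum_lintegral_clusterLaw (r : ℝ≥0) {F : ℝ → Tree → ℝ≥0∞}
    (hF : Measurable fun z : ℝ × Tree => F z.1 z.2) :
    ∑' m : ℤ, ∫⁻ v, F (m + v.1) v.2 ∂(clusterLaw r) = ∫⁻ y, (∫⁻ x, F x y) ∂(treeLaw r) := by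
  have hm : ∀ m : ℤ, Measurable fun v : Cluster => F (m + v.1) v.2 := fun m =>
    hF.comp (f := fun v : Cluster => ((m : ℝ) + v.1, v.2)) (by fun_prop)
  have h1 : ∀ m : ℤ, ∫⁻ v, F (m + v.1) v.2 ∂(clusterLaw r) =
      ∫⁻ y, (∫⁻ u : unitInterval, F (m + u) y) ∂(treeLaw r) := fun m => by
    rw [clusterLaw, lintegral_prod_symm' _ (hm m)]
  simp_rw [h1]
  rw [← lintegral_tsum fun m => (Measurable.lintegral_prod_left' (hm m)).aemeasurable]
  refine lintegral_congr fun y => ?_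
  rw [tsum_lintegral_unitInterval (fun x => F x y)
    (hF.comp (f := fun x : ℝ => (x, y)) (by fun_prop))]

/-- By translation invariance every individual of the cluster contributes the length of `B`,
whatever its age. All bins of equal length thus get the same total mean. -/
lemma tsum_lintegral_count (r : ℝ≥0) {B : Set ℝ} (hB : MeasurableSet B)
    {h : (List ℕ → ℕ) → ℝ≥0∞} (hh : Measurable h) :
    ∑' m : ℤ, ∫⁻ v, count B (m + v.1) v.2 * h v.2.1 ∂(clusterLaw r) =
      volume B * ∫⁻ c, size c * h c ∂(offspringLaw r) := by
  have hm := measurable_count hB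
  rw [tsum_lintegral_clusterLaw r (F := fun x y => count B x y * h y.1) (by fun_prop)]
  have h1 : ∀ y : Tree, ∫⁻ x, count B x y * h y.1 = volume B * (size y.1 * h y.1) := fun y => by
    have hm' : Measurable fun x => count B x y := hm.comp (f := fun x : ℝ => (x, y)) (by fun_prop)
    rw [lintegral_mul_const _ hm', lintegral_count hB, mul_assoc]
  simp_rw [h1]
  rw [lintegral_const_mul _ (by fun_prop), treeLaw]
  congr 1
  rw [lintegral_prod _ (by fun_prop)]
  simp

open scoped Classical in
lemma tsum_lintegral_count_ne_zero_le {r : ℝ≥0} (hr : r < 1) (T : ℝ)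
    {h : (List ℕ → ℕ) → ℝ≥0∞} (hh : Measurable h) :
    ∑' m : ℤ, ∫⁻ v, (if count (Set.Ioc 0 T) (m + v.1) v.2 ≠ 0 then 1 else 0) * h v.2.1
        ∂(clusterLaw r) ≤
      ENNReal.ofReal T * ∫⁻ c, h c ∂(offspringLaw r) +
        ∫⁻ c, (size c - 1) * h c ∂(offspringLaw r) := by
  have hm : Measurable fun z : ℝ × Tree =>
      if count (Set.Ioc 0 T) z.1 z.2 ≠ 0 then (1 : ℝ≥0∞) else 0 :=
    Measurable.ite ((measurable_count measurableSet_Ioc) (measurableSet_singleton 0).compl)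
      measurable_const measurable_const
  rw [tsum_lintegral_clusterLaw r
    (F := fun x y => (if count (Set.Ioc 0 T) x y ≠ 0 then 1 else 0) * h y.1) (by fun_prop),
    ← lintegral_life_mul r hh hr]
  have h1 : ∫⁻ c, h c ∂(offspringLaw r) = ∫⁻ y, h y.1 ∂(treeLaw r) := by
    rw [treeLaw, lintegral_prod _ (by fun_prop)]
    simp
  rw [h1, ← lintegral_const_mul _ (by fun_prop), ← lintegral_add_left (by fun_prop)]
  refine lintegral_mono_ae ?_
  filter_upwards [ae_treeLaw_nonneg r] with y hy
  have hm' : Measurable fun x => if count (Set.Ioc 0 T) x y ≠ 0 then (1 : ℝ≥0∞) else 0 :=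
    hm.comp (f := fun x : ℝ => (x, y)) (by fun_prop)
  rw [lintegral_mul_const _ hm', ← add_mul]
  gcongr
  exact lintegral_count_ne_zero_le hy

/-! ### The clusters of the Hawkes process -/

/-- The positions, offspring numbers and delays of all potential clusters. -/
abbrev ClusterSource : Type := (ℤ × ℕ → unitInterval) × (Label → ℕ) × (Label → ℝ)

/-- The block counts are kept apart: in the Mecke formula the clusters are integrated first, with
the counts fixed. -/
def clusterSourceLaw (r : ℝ≥0) : Measure ClusterSource :=
  (Measure.infinitePi fun _ : ℤ × ℕ => (volume : Measure unitInterval)).prod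
    ((Measure.infinitePi fun _ : Label => poissonMeasure r).prod
      (Measure.infinitePi fun _ : Label => expMeasure 1))

instance (r : ℝ≥0) : IsProbabilityMeasure (clusterSourceLaw r) := by
  unfold clusterSourceLaw; infer_instance

lemma sourceLaw_eq (μ α : ℝ) : sourceLaw μ α =
    (Measure.infinitePi fun _ : ℤ => poissonMeasure μ.toNNReal).prod
      (clusterSourceLaw α.toNNReal) := rfl

/-- The cluster of the immigrant `a`. -/
def cluster (η : ClusterSource) (a : ℤ × ℕ) : Cluster :=
  (η.1 a, fun q => η.2.1 (a.1, a.2, q), fun q => η.2.2 (a.1, a.2, q))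

@[fun_prop]
lemma measurable_cluster (a : ℤ × ℕ) : Measurable fun η => cluster η a := by
  unfold cluster; fun_prop

lemma lintegral_prod_cluster (r : ℝ≥0) (A : Finset (ℤ × ℕ)) (h : ℤ × ℕ → Cluster → ℝ≥0∞)
    (mh : ∀ a, Measurable (h a)) :
    ∫⁻ η, ∏ a ∈ A, h a (cluster η a) ∂(clusterSourceLaw r) =
      ∏ a ∈ A, ∫⁻ v, h a v ∂(clusterLaw r) := by
  refine lintegral_prod_pair (X := fun a (u : ℤ × ℕ → unitInterval) => u a)
    (Y := fun a (z : (Label → ℕ) × (Label → ℝ)) =>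
      ((fun q => z.1 (a.1, a.2, q), fun q => z.2 (a.1, a.2, q)) : Tree))
    (by fun_prop) (by fun_prop) (fun A h mh => lintegral_prod_infinitePi _ A h mh)
    (ν := treeLaw r) ?_ A h mh
  intro A h mh
  exact lintegral_prod_pair (X := fun a (z : Label → ℕ) q => z (a.1, a.2, q))
    (Y := fun a (z : Label → ℝ) q => z (a.1, a.2, q)) (by fun_prop) (by fun_prop)
    (μ := offspringLaw r) (ν := Measure.infinitePi fun _ : List ℕ => expMeasure 1)
    (fun A h mh => lintegral_prod_infinitePi_block _ A h mh)
    (fun A h mh => lintegral_prod_infinitePi_block _ A h mh) A h mh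

lemma map_cluster (r : ℝ≥0) (a : ℤ × ℕ) (h : Cluster → ℝ≥0∞) (mh : Measurable h) :
    ∫⁻ η, h (cluster η a) ∂(clusterSourceLaw r) = ∫⁻ v, h v ∂(clusterLaw r) := by
  simpa using lintegral_prod_cluster r {a} (fun _ => h) fun _ => mh

/-- The immigrants in the blocks `I`, when `X m` immigrants arrive in block `m`. -/
def born (I : Finset ℤ) (X : ℤ → ℕ) : Finset (ℤ × ℕ) :=
  (I.sigma fun m => Finset.range (X m)).map (Equiv.sigmaEquivProd ℤ ℕ).toEmbedding

lemma mem_born {I : Finset ℤ} {X : ℤ → ℕ} {a : ℤ × ℕ} : a ∈ born I X ↔ a.1 ∈ I ∧ a.2 < X a.1 := by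
  simp [born, Equiv.sigmaEquivProd]

lemma sum_born {I : Finset ℤ} {X : ℤ → ℕ} (F : ℤ × ℕ → ℝ≥0∞) :
    ∑ a ∈ born I X, F a = ∑ m ∈ I, ∑ k ∈ Finset.range (X m), F (m, k) := by
  rw [born, Finset.sum_map, Finset.sum_sigma]
  rfl

lemma prod_born {I : Finset ℤ} {X : ℤ → ℕ} (F : ℤ × ℕ → ℝ≥0∞) :
    ∏ a ∈ born I X, F a = ∏ m ∈ I, ∏ k ∈ Finset.range (X m), F (m, k) := by
  rw [born, Finset.prod_map, Finset.prod_sigma]; rfl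

/-- Sums over a random index set are measurable because that set takes countably many values, in a
space given the discrete σ-algebra. -/
lemma measurable_born {Ω β : Type*} [MeasurableSpace Ω] [MeasurableSpace β] {I : Finset ℤ}
    {X : Ω → ℤ → ℕ} (hX : Measurable X) {F : Finset (ℤ × ℕ) → Ω → β} (hF : ∀ A, Measurable (F A)) :
    Measurable fun ω => F (born I (X ω)) ω := by
  let _ : MeasurableSpace (Finset (ℤ × ℕ)) := ⊤
  have hb : Measurable fun ω => born I (X ω) := by
    refine measurable_to_countable' fun A => ?_
    have : (fun ω => born I (X ω)) ⁻¹' {A} =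
        ⋂ a : ℤ × ℕ, {ω | a.1 ∈ I ∧ a.2 < X ω a.1 ↔ a ∈ A} := by
      ext ω
      simp only [Set.mem_preimage, Set.mem_singleton_iff, Set.mem_iInter, Set.mem_ofPred_eq,
        Finset.ext_iff, mem_born]
    rw [this]
    refine MeasurableSet.iInter fun a => ?_
    have h1 : MeasurableSet {ω | a.2 < X ω a.1} := measurableSet_lt measurable_const (by fun_prop)
    exact ((MeasurableSet.const _).inter h1).iff (MeasurableSet.const _)
  exact (measurable_from_prod_countable_right
    (f := fun x : Finset (ℤ × ℕ) × Ω => F x.1 x.2) hF).comp (hb.prodMk measurable_id)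

/-- The Mecke formula for the clusters with immigrants in the blocks `I`. -/
lemma lintegral_sum_mul_prod_cluster (μ α : ℝ) (I : Finset ℤ) {f g : ℤ → Cluster → ℝ≥0∞}
    (hf : ∀ m, Measurable (f m)) (hg : ∀ m, Measurable (g m)) {γ : ℤ → ℝ≥0}
    (hγ : ∀ m, ∫⁻ v, g m v ∂(clusterLaw α.toNNReal) = γ m) :
    ∫⁻ ω, ∑ a ∈ born I ω.1, f a.1 (cluster ω.2 a) *
        ∏ b ∈ (born I ω.1).erase a, g b.1 (cluster ω.2 b) ∂(sourceLaw μ α) =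
      (∑ m ∈ I, ∫⁻ v, f m v ∂(clusterLaw α.toNNReal)) *
        (μ.toNNReal * ENNReal.ofReal (Real.exp (∑ m ∈ I, μ.toNNReal * (γ m - 1)))) := by
  rw [sourceLaw_eq, lintegral_prod _ (measurable_born (X := Prod.fst)
    (F := fun A (ω : (ℤ → ℕ) × ClusterSource) => ∑ a ∈ A, f a.1 (cluster ω.2 a) *
        ∏ b ∈ A.erase a, g b.1 (cluster ω.2 b)) (by fun_prop) (fun A => by fun_prop)).aemeasurable]
  have h1 : ∀ X : ℤ → ℕ, ∫⁻ η, ∑ a ∈ born I X, f a.1 (cluster η a) *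
        ∏ b ∈ (born I X).erase a, g b.1 (cluster η b) ∂(clusterSourceLaw α.toNNReal) =
      ∑ m ∈ I, ((∫⁻ v, f m v ∂(clusterLaw α.toNNReal)) * (X m * (γ m : ℝ≥0∞) ^ (X m - 1))) *
        ∏ m' ∈ I.erase m, (γ m' : ℝ≥0∞) ^ X m' := by
    intro X
    rw [lintegral_sum_mul_prod_erase (V := fun a η => cluster η a) (f := fun a => f a.1)
      (g := fun a => g a.1) (ν := clusterLaw α.toNNReal) (by fun_prop)
      (fun h mh => lintegral_prod_cluster _ _ h mh) (fun a => hf _) (fun a => hg _), sum_born]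
    refine Finset.sum_congr rfl fun m hm => ?_
    have h2 : ∀ k ∈ Finset.range (X m), ∏ b ∈ (born I X).erase (m, k),
        ∫⁻ v, g b.1 v ∂(clusterLaw α.toNNReal) =
        (γ m : ℝ≥0∞) ^ (X m - 1) * ∏ m' ∈ I.erase m, (γ m' : ℝ≥0∞) ^ X m' := by
      intro k hk
      have h3 : ∀ (A : Finset (ℤ × ℕ)) (a : ℤ × ℕ) (F : ℤ × ℕ → ℝ≥0∞), a ∈ A →
          ∏ b ∈ A.erase a, F b = ∏ b ∈ A, if b = a then 1 else F b := by
        intro A a F ha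
        rw [← Finset.mul_prod_erase A _ ha, if_pos rfl, one_mul]
        exact Finset.prod_congr rfl fun b hb => (if_neg (Finset.ne_of_mem_erase hb)).symm
      rw [h3 _ _ _ (mem_born.2 ⟨hm, Finset.mem_range.1 hk⟩), prod_born,
        ← Finset.mul_prod_erase I _ hm]
      congr 1
      · rw [← Finset.mul_prod_erase _ _ hk, if_pos rfl, one_mul]
        rw [Finset.prod_congr rfl (g := fun _ => (γ m : ℝ≥0∞)), Finset.prod_const,
          Finset.card_erase_of_mem hk, Finset.card_range]
        intro k' hk'
        rw [if_neg, hγ]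
        simpa using Finset.ne_of_mem_erase hk'
      · refine Finset.prod_congr rfl fun m' hm' => ?_
        rw [Finset.prod_congr rfl (g := fun _ => (γ m' : ℝ≥0∞)), Finset.prod_const,
          Finset.card_range]
        intro k' hk'
        rw [if_neg, hγ]
        have := Finset.ne_of_mem_erase hm'
        simp [this]
    have h4 : ∀ k ∈ Finset.range (X m), (∫⁻ v, f m v ∂(clusterLaw α.toNNReal)) *
        ∏ b ∈ (born I X).erase (m, k), ∫⁻ v, g b.1 v ∂(clusterLaw α.toNNReal) =
        (∫⁻ v, f m v ∂(clusterLaw α.toNNReal)) * ((γ m : ℝ≥0∞) ^ (X m - 1) *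
          ∏ m' ∈ I.erase m, (γ m' : ℝ≥0∞) ^ X m') := fun k hk => by rw [h2 k hk]
    rw [Finset.sum_congr rfl h4, Finset.sum_const, Finset.card_range, nsmul_eq_mul]
    ring
  simp_rw [h1]
  rw [lintegral_sum_mul_prod_erase (V := fun m (X : ℤ → ℕ) => X m)
    (f := fun m n => (∫⁻ v, f m v ∂(clusterLaw α.toNNReal)) * (n * (γ m : ℝ≥0∞) ^ (n - 1)))
    (g := fun m n => (γ m : ℝ≥0∞) ^ n) (ν := poissonMeasure μ.toNNReal) (by fun_prop)
    (fun h mh => lintegral_prod_infinitePi _ _ h mh) (fun a => measurable_of_countable _)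
    (fun a => measurable_of_countable _), Finset.sum_mul]
  refine Finset.sum_congr rfl fun m hm => ?_
  rw [lintegral_const_mul _ (measurable_of_countable _), lintegral_mul_pow_poissonMeasure]
  simp_rw [lintegral_pow_poissonMeasure]
  rw [mul_assoc, mul_assoc, Finset.mul_prod_erase I
    (fun m => ENNReal.ofReal (Real.exp (μ.toNNReal * (γ m - 1)))) hm,
    ← ENNReal.ofReal_prod_of_nonneg (fun _ _ => by positivity), ← Real.exp_sum]

lemma one_le_count {B : Set ℝ} {x : ℝ} {y : Tree} (h : count B x y ≠ 0) : 1 ≤ count B x y := by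
  classical
  obtain ⟨p, hp⟩ : ∃ p, Alive y.1 p ∧ x + age y.2 p ∈ B := by
    by_contra! hne
    exact h (ENNReal.tsum_eq_zero.2 fun p => if_neg fun hp => hne p hp.1 hp.2)
  refine le_trans ?_ (ENNReal.le_tsum p)
  rw [if_pos hp]

/-- A first-moment bound: Markov's inequality and the Mecke formula with trivial second factor,
block by block. -/
lemma measure_count_ne_zero_le (μ α : ℝ) {B : Set ℝ} (hB : MeasurableSet B) (I : Set ℤ) :
    sourceLaw μ α {ω | ∃ a : ℤ × ℕ, a.1 ∈ I ∧ a.2 < ω.1 a.1 ∧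
        count B (a.1 + (cluster ω.2 a).1) (cluster ω.2 a).2 ≠ 0} ≤
      ∑' m : I, μ.toNNReal *
        ∫⁻ v, count B ((m : ℤ) + v.1) v.2 ∂(clusterLaw α.toNNReal) := by
  have hc : ∀ m : ℤ, Measurable fun v : Cluster => count B (m + v.1) v.2 := fun m =>
    (measurable_count hB).comp (f := fun v : Cluster => ((m : ℝ) + v.1, v.2)) (by fun_prop)
  have h1 : ∀ m : ℤ, sourceLaw μ α {ω | ∃ k < ω.1 m,
      count B (m + (cluster ω.2 (m, k)).1) (cluster ω.2 (m, k)).2 ≠ 0} ≤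
      μ.toNNReal * ∫⁻ v, count B (m + v.1) v.2 ∂(clusterLaw α.toNNReal) := by
    intro m
    have hM := lintegral_sum_mul_prod_cluster μ α {m} (f := fun m v => count B (m + v.1) v.2)
      (g := fun _ _ => 1) hc (fun _ => measurable_const) (γ := fun _ => 1) (by simp)
    simp only [Finset.prod_const_one, mul_one, NNReal.coe_one, sub_self, mul_zero,
      Finset.sum_const_zero, Real.exp_zero, ENNReal.ofReal_one, Finset.sum_singleton] at hM
    rw [mul_comm, ← hM]
    have hc' : ∀ a : ℤ × ℕ, Measurable fun ω : Source =>
        count B (a.1 + (cluster ω.2 a).1) (cluster ω.2 a).2 := fun a =>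
      (hc a.1).comp (f := fun ω : Source => cluster ω.2 a) (by fun_prop)
    have hmeas : Measurable fun ω : Source => ∑ a ∈ born {m} ω.1,
        count B (a.1 + (cluster ω.2 a).1) (cluster ω.2 a).2 :=
      measurable_born (F := fun A (ω : Source) => ∑ a ∈ A,
        count B (a.1 + (cluster ω.2 a).1) (cluster ω.2 a).2) (by fun_prop)
        (fun A => Finset.measurable_fun_sum _ fun a _ => hc' a)
    refine le_trans (measure_mono ?_) (le_of_eq_of_le (one_mul _).symm
      (mul_meas_ge_le_lintegral hmeas 1))
    rintro ω ⟨k, hk, hne⟩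
    refine (one_le_count hne).trans ?_
    exact Finset.single_le_sum (f := fun a : ℤ × ℕ =>
      count B (a.1 + (cluster ω.2 a).1) (cluster ω.2 a).2) (fun _ _ => zero_le)
      (mem_born.2 ⟨Finset.mem_singleton_self m, hk⟩)
  refine le_trans (measure_mono ?_) ((measure_iUnion_le _).trans
    (ENNReal.tsum_le_tsum fun m : I => h1 m))
  rintro ω ⟨⟨m, k⟩, hm, hk, hne⟩
  exact Set.mem_iUnion.2 ⟨⟨m, hm⟩, k, hk, hne⟩

/-! ### Exponential moments of the contrast between a bin and the other bins -/

lemma measurePreserving_offspring (r : ℝ≥0) :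
    MeasurePreserving (fun v : Cluster => v.2.1) (clusterLaw r) (offspringLaw r) :=
  (measurePreserving_fst (μ := offspringLaw r)
    (ν := Measure.infinitePi fun _ : List ℕ => expMeasure 1)).comp
    (measurePreserving_snd (μ := (volume : Measure unitInterval)) (ν := treeLaw r))

/-- The `j`-th time bin. -/
def bin (Δ : ℝ) (j : ℕ) : Set ℝ := Set.Ioc ((j : ℝ) * Δ) (((j : ℝ) + 1) * Δ)

lemma measurableSet_bin (Δ : ℝ) (j : ℕ) : MeasurableSet (bin Δ j) := measurableSet_Ioc

lemma volume_bin (Δ : ℝ) (j : ℕ) : volume (bin Δ j) = ENNReal.ofReal Δ := by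
  rw [bin, Real.volume_Ioc]
  congr 1
  ring

lemma pairwiseDisjoint_bin {Δ : ℝ} (hΔ : 0 < Δ) (s : Set ℕ) : s.PairwiseDisjoint (bin Δ) := by
  intro i _ j _ hij
  wlog h : i < j generalizing i j
  · exact (this ‹_› ‹_› hij.symm (lt_of_le_of_ne (not_lt.1 h) hij.symm)).symm
  rw [Function.onFun, Set.disjoint_left]
  rintro x ⟨-, h1⟩ ⟨h2, -⟩
  have : (i : ℝ) + 1 ≤ j := by exact_mod_cast h
  nlinarith

lemma biUnion_bin {Δ : ℝ} (hΔ : 0 < Δ) (K : ℕ) :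
    ⋃ j ∈ Finset.range K, bin Δ j = Set.Ioc 0 (K * Δ) := by
  ext x
  simp only [Set.mem_iUnion, Finset.mem_range, exists_prop, bin, Set.mem_Ioc]
  constructor
  · rintro ⟨j, hj, h1, h2⟩
    have : (j : ℝ) + 1 ≤ K := by exact_mod_cast hj
    exact ⟨lt_of_le_of_lt (by positivity) h1, h2.trans (by gcongr)⟩
  · rintro ⟨h1, h2⟩
    -- The bins are open on the left and closed on the right, so the index of x is the ceiling of
    -- x/Δ minus one, not the floor.
    have hc : 0 < ⌈x / Δ⌉₊ := Nat.ceil_pos.2 (by positivity)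
    have h3 : ((⌈x / Δ⌉₊ - 1 : ℕ) : ℝ) = (⌈x / Δ⌉₊ : ℝ) - 1 := by
      rw [Nat.cast_sub hc]; simp
    refine ⟨⌈x / Δ⌉₊ - 1, ?_, ?_, ?_⟩
    · have : ⌈x / Δ⌉₊ ≤ K := Nat.ceil_le.2 ((div_le_iff₀ hΔ).2 h2)
      omega
    · rw [h3, ← lt_div_iff₀ hΔ]
      have := Nat.ceil_lt_add_one (a := x / Δ) (by positivity)
      linarith
    · rw [h3, sub_add_cancel, ← div_le_iff₀ hΔ]
      exact Nat.le_ceil _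

/-- The number of events of a cluster in the `j`-th bin. -/
def clusterCount (Δ : ℝ) (j : ℕ) (m : ℤ) (v : Cluster) : ℝ :=
  (count (bin Δ j) (m + v.1) v.2).toReal

@[fun_prop]
lemma measurable_count_cluster {B : Set ℝ} (hB : MeasurableSet B) (m : ℤ) :
    Measurable fun v : Cluster => count B (m + v.1) v.2 :=
  (measurable_count hB).comp (f := fun v : Cluster => ((m : ℝ) + v.1, v.2)) (by fun_prop)

@[fun_prop]
lemma measurable_clusterCount (Δ : ℝ) (j : ℕ) (m : ℤ) : Measurable (clusterCount Δ j m) :=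
  (measurable_count_cluster (measurableSet_bin Δ j) m).ennreal_toReal

/-- The number of events of a cluster in the `j`-th bin, minus the mean over the other bins. -/
def contrast (K : ℕ) (Δ : ℝ) (j : ℕ) (m : ℤ) (v : Cluster) : ℝ :=
  clusterCount Δ j m v - (∑ i ∈ (Finset.range K).erase j, clusterCount Δ i m v) / (K - 1)

@[fun_prop]
lemma measurable_contrast (K : ℕ) (Δ : ℝ) (j : ℕ) (m : ℤ) : Measurable (contrast K Δ j m) := by
  unfold contrast; fun_prop

lemma clusterCount_nonneg (Δ : ℝ) (j : ℕ) (m : ℤ) (v : Cluster) : 0 ≤ clusterCount Δ j m v :=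
  ENNReal.toReal_nonneg

lemma count_ne_top {B : Set ℝ} {x : ℝ} {y : Tree} (h : size y.1 ≠ ∞) : count B x y ≠ ∞ :=
  ne_top_of_le_ne_top h (count_le_size B x y)

lemma sum_clusterCount {Δ : ℝ} (hΔ : 0 < Δ) (K : ℕ) (m : ℤ) {v : Cluster} (h : size v.2.1 ≠ ∞) :
    ∑ j ∈ Finset.range K, clusterCount Δ j m v =
      (count (Set.Ioc 0 (K * Δ)) (m + v.1) v.2).toReal := by
  rw [← biUnion_bin hΔ, count_biUnion _ _ (pairwiseDisjoint_bin hΔ _),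
    ENNReal.toReal_sum fun j _ => count_ne_top h]
  rfl

lemma sum_clusterCount_le {Δ : ℝ} (hΔ : 0 < Δ) (K : ℕ) (m : ℤ) {v : Cluster}
    (h : size v.2.1 ≠ ∞) :
    ∑ j ∈ Finset.range K, clusterCount Δ j m v ≤ (size v.2.1).toReal := by
  rw [sum_clusterCount hΔ K m h]
  exact ENNReal.toReal_mono h (count_le_size _ _ _)

/-- The remainder `exp (κ * N) - 1 - κ * N`, per individual. -/
def expRemainder (κ x : ℝ) : ℝ := (Real.exp (κ * x) - 1 - κ * x) / x

/-- The remainder exp z - 1 - z is largest at positive z, and convexity bounds it by |a-b|/N times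
its value at |κ|N. The result is linear in a and b, so that bin means can be summed over all blocks.
-/
lemma exp_le_one_add_add {κ a b N : ℝ} (hN : 0 < N) (ha : 0 ≤ a) (hb : 0 ≤ b) (haN : a ≤ N)
    (hbN : b ≤ N) :
    Real.exp (κ * (a - b)) ≤ 1 + κ * (a - b) + (a + b) * expRemainder |κ| N := by
  set z := |κ * (a - b)| with hz
  set M := |κ| * N with hM
  have hab : |a - b| ≤ N := abs_le.2 ⟨by linarith, by linarith⟩
  have hab' : |a - b| ≤ a + b := abs_le.2 ⟨by linarith, by linarith⟩
  have hr : 0 ≤ Real.exp M - 1 - M := by linarith [Real.add_one_le_exp M]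
  have h1 : Real.exp (κ * (a - b)) - 1 - κ * (a - b) ≤ Real.exp z - 1 - z := by
    rcases abs_cases (κ * (a - b)) with ⟨h, _⟩ | ⟨h, h'⟩
    · rw [hz, h]
    -- For negative argument -z the claim exp(-z) + z ≤ exp z - z is z ≤ sinh z.
    · have := Real.self_le_sinh_iff.2 (abs_nonneg (κ * (a - b)))
      rw [h, Real.sinh_eq, neg_neg] at this
      rw [hz, h]
      linarith
  have h2 : Real.exp z - 1 - z ≤ |a - b| / N * (Real.exp M - 1 - M) := by
    have ht : z = |a - b| / N * M := by
      rw [hz, abs_mul, hM]; field_simp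
    have ht1 : |a - b| / N ≤ 1 := (div_le_one hN).2 hab
    have := convexOn_exp.2 (Set.mem_univ 0) (Set.mem_univ M)
      (sub_nonneg.2 ht1) (by positivity : 0 ≤ |a - b| / N) (by ring)
    simp only [smul_eq_mul, mul_zero, zero_add, Real.exp_zero, mul_one] at this
    rw [← ht] at this
    have e : |a - b| / N * (Real.exp M - 1 - M) =
      |a - b| / N * Real.exp M - |a - b| / N - |a - b| / N * M := by ring
    rw [e, ← ht]
    linarith
  have h3 : |a - b| / N * (Real.exp M - 1 - M) ≤ (a + b) * expRemainder |κ| N := by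
    rw [expRemainder, ← mul_div_assoc, div_mul_eq_mul_div]
    gcongr
  linarith

lemma expRemainder_nonneg {κ x : ℝ} (hx : 0 ≤ x) : 0 ≤ expRemainder κ x :=
  div_nonneg (by linarith [Real.add_one_le_exp (κ * x)]) hx

@[fun_prop]
lemma measurable_expRemainder (κ : ℝ) : Measurable (expRemainder κ) := by
  unfold expRemainder; fun_prop

/-- Integrate exp(κN) = 1 + κN + N·`expRemainder` κ N and cancel the first two terms, using E N =
1/(1-r). -/
lemma lintegral_size_mul_expRemainder_le {r : ℝ≥0} (hr : r < 1) {κ ρ : ℝ} (hκ : 0 ≤ κ)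
    (h : ∫⁻ c, expWeight κ (size c).toReal ∂(offspringLaw r) ≤
      ENNReal.ofReal (1 + κ / (1 - r) + ρ)) (hρ : 0 ≤ ρ) :
    ∫⁻ c, size c * ENNReal.ofReal (expRemainder κ (size c).toReal) ∂(offspringLaw r) ≤
      ENNReal.ofReal ρ := by
  have h0 : (0 : ℝ) < 1 - r := by
    have : (r : ℝ) < 1 := by exact_mod_cast hr
    linarith
  have e : ∫⁻ c, expWeight κ (size c).toReal ∂(offspringLaw r) =
      ∫⁻ c, ((1 + ENNReal.ofReal κ * size c) +
        size c * ENNReal.ofReal (expRemainder κ (size c).toReal)) ∂(offspringLaw r) := by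
    refine lintegral_congr_ae ?_
    filter_upwards [ae_size_ne_top hr] with c hc
    have h1 : 1 ≤ (size c).toReal := by
      have := ENNReal.toReal_mono hc (one_le_size c)
      simpa using this
    conv_rhs => rw [← ENNReal.ofReal_toReal hc]
    rw [ENNReal.toReal_ofReal (by positivity), ← ENNReal.ofReal_one,
      ← ENNReal.ofReal_mul hκ, ← ENNReal.ofReal_mul (by positivity),
      ← ENNReal.ofReal_add (by positivity) (by positivity),
      ← ENNReal.ofReal_add (by positivity)
        (mul_nonneg (by positivity) (expRemainder_nonneg (by positivity)))]
    rw [expWeight, expRemainder]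
    congr 1
    field_simp
    ring
  rw [e, lintegral_add_left (by fun_prop), lintegral_add_left (by fun_prop),
    lintegral_const_mul _ (by fun_prop), lintegral_size hr, add_assoc,
    ENNReal.ofReal_add (by positivity) hρ, ENNReal.ofReal_add (by positivity) (by positivity),
    add_assoc, ← ENNReal.ofReal_mul hκ] at h
  simp only [lintegral_const, measure_univ, mul_one, ENNReal.ofReal_one, mul_one_div] at h
  exact (ENNReal.add_le_add_iff_left (by simp)).1
    ((ENNReal.add_le_add_iff_left (by simp)).1 h)

section Contrast

variable {r : ℝ≥0} {κ ρ Δ : ℝ} {K : ℕ}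

lemma avg_clusterCount_mem (hΔ : 0 < Δ) (hK : 2 ≤ K) {j : ℕ} (hj : j < K) (m : ℤ) {v : Cluster}
    (h : size v.2.1 ≠ ∞) :
    0 ≤ (∑ i ∈ (Finset.range K).erase j, clusterCount Δ i m v) / ((K : ℝ) - 1) ∧
    (∑ i ∈ (Finset.range K).erase j, clusterCount Δ i m v) / ((K : ℝ) - 1) ≤
      (size v.2.1).toReal ∧
    clusterCount Δ j m v ≤ (size v.2.1).toReal := by
  have hK' : (1 : ℝ) ≤ K - 1 := by
    have : (2 : ℝ) ≤ K := by exact_mod_cast hK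
    linarith
  have hn : 0 ≤ ∑ i ∈ (Finset.range K).erase j, clusterCount Δ i m v :=
    Finset.sum_nonneg fun i _ => clusterCount_nonneg _ _ _ _
  have hs := sum_clusterCount_le hΔ K m h
  rw [← Finset.add_sum_erase _ _ (Finset.mem_range.2 hj)] at hs
  have h0 := clusterCount_nonneg Δ j m v
  refine ⟨by positivity, ?_, by linarith⟩
  exact (div_le_self hn hK').trans (by linarith)

lemma one_le_size_toReal {c : List ℕ → ℕ} (h : size c ≠ ∞) : 1 ≤ (size c).toReal := by
  simpa using ENNReal.toReal_mono h (one_le_size c)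

lemma lintegral_exp_contrast_ne_top (hr : r < 1) (hΔ : 0 < Δ) (hK : 2 ≤ K)
    (h : ∫⁻ c, expWeight |κ| (size c).toReal ∂(offspringLaw r) ≠ ∞) {j : ℕ} (hj : j < K) (m : ℤ) :
    ∫⁻ v, ENNReal.ofReal (Real.exp (κ * contrast K Δ j m v)) ∂(clusterLaw r) ≠ ∞ := by
  refine ne_top_of_le_ne_top h ?_
  rw [← (measurePreserving_offspring r).lintegral_comp (by fun_prop)]
  refine lintegral_mono_ae ?_
  filter_upwards [(measurePreserving_offspring r).quasiMeasurePreserving.ae (ae_size_ne_top hr)]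
    with v hv
  obtain ⟨h1, h2, h3⟩ := avg_clusterCount_mem hΔ hK hj m hv
  have h4 := clusterCount_nonneg Δ j m v
  refine ENNReal.ofReal_le_ofReal (Real.exp_le_exp.2 ((le_abs_self _).trans ?_))
  rw [abs_mul]
  gcongr
  exact abs_le.2 ⟨by rw [contrast]; linarith, by rw [contrast]; linarith⟩

lemma integrable_of_le_size (hr : r < 1) {F : Cluster → ℝ} (hF : Measurable F)
    {h : (List ℕ → ℕ) → ℝ≥0∞} (hm : Measurable h) (hh : ∫⁻ c, h c ∂(offspringLaw r) ≠ ∞)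
    (hle : ∀ v : Cluster, size v.2.1 ≠ ∞ → ENNReal.ofReal |F v| ≤ h v.2.1) :
    Integrable F (clusterLaw r) := by
  refine ⟨hF.aestronglyMeasurable, ?_⟩
  rw [hasFiniteIntegral_iff_norm]
  refine lt_of_le_of_lt ?_ hh.lt_top
  rw [← (measurePreserving_offspring r).lintegral_comp hm]
  refine lintegral_mono_ae ?_
  filter_upwards [(measurePreserving_offspring r).quasiMeasurePreserving.ae (ae_size_ne_top hr)]
    with v hv using hle v hv

/-- Mean number of events of a cluster of block `m` in bin `j`, weighted by `h`. -/
def binMean (r : ℝ≥0) (Δ : ℝ) (h : (List ℕ → ℕ) → ℝ≥0∞) (j : ℕ) (m : ℤ) : ℝ :=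
  (∫⁻ v, count (bin Δ j) (m + v.1) v.2 * h v.2.1 ∂(clusterLaw r)).toReal

lemma hasSum_binMean (hΔ : 0 < Δ) {h : (List ℕ → ℕ) → ℝ≥0∞} (hm : Measurable h)
    (hfin : ∫⁻ c, size c * h c ∂(offspringLaw r) ≠ ∞) (j : ℕ) :
    HasSum (binMean r Δ h j) (Δ * (∫⁻ c, size c * h c ∂(offspringLaw r)).toReal) := by
  have e := tsum_lintegral_count r (measurableSet_bin Δ j) hm
  rw [volume_bin] at e
  have hne : ENNReal.ofReal Δ * ∫⁻ c, size c * h c ∂(offspringLaw r) ≠ ∞ :=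
    ENNReal.mul_ne_top (by simp) hfin
  have h1 := e ▸ hne
  have h2 := ENNReal.tsum_toReal_eq fun m => ENNReal.ne_top_of_tsum_ne_top h1 m
  have := ENNReal.hasSum_toReal h1
  rw [← h2, e, ENNReal.toReal_mul, ENNReal.toReal_ofReal hΔ.le] at this
  exact this

lemma binMean_nonneg (h : (List ℕ → ℕ) → ℝ≥0∞) (j : ℕ) (m : ℤ) : 0 ≤ binMean r Δ h j m :=
  ENNReal.toReal_nonneg

/-- The mean contrast. -/
def meanContrast (r : ℝ≥0) (K : ℕ) (Δ : ℝ) (j : ℕ) (m : ℤ) : ℝ :=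
  binMean r Δ (fun _ => 1) j m -
    (∑ i ∈ (Finset.range K).erase j, binMean r Δ (fun _ => 1) i m) / (K - 1)

/-- Each bin has total mean Δ·E N, and the K - 1 other bins are averaged, so the contrast is
centred. -/
lemma hasSum_meanContrast (hr : r < 1) (hΔ : 0 < Δ) (hK : 2 ≤ K) {j : ℕ} (hj : j < K) :
    HasSum (meanContrast r K Δ j) 0 := by
  have hfin : ∫⁻ c, size c * 1 ∂(offspringLaw r) ≠ ∞ := by
    simp [lintegral_size hr]
  have hs := hasSum_binMean hΔ (h := fun _ => 1) measurable_const hfin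
  have := (hs j).sub ((hasSum_sum (s := (Finset.range K).erase j) fun i _ => hs i).div_const
    ((K : ℝ) - 1))
  have hK' : (K : ℝ) - 1 ≠ 0 := by
    have : (2 : ℝ) ≤ K := by exact_mod_cast hK
    linarith
  rw [Finset.sum_const, Finset.card_erase_of_mem (Finset.mem_range.2 hj), Finset.card_range,
    nsmul_eq_mul, Nat.cast_sub (by omega), Nat.cast_one, mul_div_cancel_left₀ _ hK',
    sub_self] at this
  exact this

lemma lintegral_exp_contrast_le (hr : r < 1) (hΔ : 0 < Δ) (hK : 2 ≤ K)
    (h : ∫⁻ c, expWeight |κ| (size c).toReal ∂(offspringLaw r) ≠ ∞)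
    (hfin : ∫⁻ c, size c * ENNReal.ofReal (expRemainder |κ| (size c).toReal)
      ∂(offspringLaw r) ≠ ∞) {j : ℕ} (hj : j < K) (m : ℤ) :
    (∫⁻ v, ENNReal.ofReal (Real.exp (κ * contrast K Δ j m v)) ∂(clusterLaw r)).toReal - 1 ≤
      κ * meanContrast r K Δ j m +
      (binMean r Δ (fun c => ENNReal.ofReal (expRemainder |κ| (size c).toReal)) j m +
       (∑ i ∈ (Finset.range K).erase j,
        binMean r Δ (fun c => ENNReal.ofReal (expRemainder |κ| (size c).toReal)) i m) / (K - 1)) := by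
  have hsz : ∫⁻ c, size c ∂(offspringLaw r) ≠ ∞ := by simp [lintegral_size hr]
  have hae := (measurePreserving_offspring r).quasiMeasurePreserving.ae (ae_size_ne_top hr)
  have i1 : ∀ i, Integrable (clusterCount Δ i m) (clusterLaw r) := fun i =>
    integrable_of_le_size hr (by fun_prop) measurable_size hsz fun v hv => by
      rw [abs_of_nonneg (clusterCount_nonneg _ _ _ _), clusterCount,
        ENNReal.ofReal_toReal (count_ne_top hv)]
      exact count_le_size _ _ _
  have i2 : ∀ i, Integrable (fun v => clusterCount Δ i m v *
      expRemainder |κ| (size v.2.1).toReal) (clusterLaw r) := fun i =>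
    integrable_of_le_size hr (by fun_prop)
      (h := fun c => size c * ENNReal.ofReal (expRemainder |κ| (size c).toReal))
      (by fun_prop) hfin fun v hv => by
        rw [abs_of_nonneg (mul_nonneg (clusterCount_nonneg _ _ _ _)
          (expRemainder_nonneg (by positivity))),
          ENNReal.ofReal_mul (clusterCount_nonneg _ _ _ _), clusterCount,
          ENNReal.ofReal_toReal (count_ne_top hv)]
        gcongr
        exact count_le_size _ _ _
  have i3 : Integrable (fun v => Real.exp (κ * contrast K Δ j m v)) (clusterLaw r) := by
    refine ⟨Measurable.aestronglyMeasurable (by fun_prop), ?_⟩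
    rw [hasFiniteIntegral_iff_ofReal (ae_of_all _ fun v => by positivity)]
    exact (lintegral_exp_contrast_ne_top hr hΔ hK h hj m).lt_top
  have e1 : ∀ i, ∫ v, clusterCount Δ i m v ∂(clusterLaw r) = binMean r Δ (fun _ => 1) i m := by
    intro i
    rw [integral_eq_lintegral_of_nonneg_ae (ae_of_all _ fun v => clusterCount_nonneg _ _ _ _)
      (by fun_prop), binMean]
    congr 1
    refine lintegral_congr_ae ?_
    filter_upwards [hae] with v hv
    rw [clusterCount, ENNReal.ofReal_toReal (count_ne_top hv), mul_one]
  have e2 : ∀ i, ∫ v, clusterCount Δ i m v * expRemainder |κ| (size v.2.1).toReal ∂(clusterLaw r) =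
      binMean r Δ (fun c => ENNReal.ofReal (expRemainder |κ| (size c).toReal)) i m := by
    intro i
    rw [integral_eq_lintegral_of_nonneg_ae (ae_of_all _ fun v =>
      mul_nonneg (clusterCount_nonneg _ _ _ _) (expRemainder_nonneg (by positivity)))
      (by fun_prop), binMean]
    congr 1
    refine lintegral_congr_ae ?_
    filter_upwards [hae] with v hv
    rw [ENNReal.ofReal_mul (clusterCount_nonneg _ _ _ _), clusterCount,
      ENNReal.ofReal_toReal (count_ne_top hv)]
  have e3 : (∫⁻ v, ENNReal.ofReal (Real.exp (κ * contrast K Δ j m v)) ∂(clusterLaw r)).toReal =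
      ∫ v, Real.exp (κ * contrast K Δ j m v) ∂(clusterLaw r) :=
    (integral_eq_lintegral_of_nonneg_ae (ae_of_all _ fun v => by positivity) (by fun_prop)).symm
  have i4 : Integrable (contrast K Δ j m) (clusterLaw r) :=
    (i1 j).sub ((integrable_finsetSum _ fun i _ => i1 i).div_const _)
  have i5 : Integrable (fun v => (clusterCount Δ j m v * expRemainder |κ| (size v.2.1).toReal +
        (∑ i ∈ (Finset.range K).erase j, clusterCount Δ i m v *
          expRemainder |κ| (size v.2.1).toReal) / (K - 1))) (clusterLaw r) :=
    (i2 j).add ((integrable_finsetSum _ fun i _ => i2 i).div_const _)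
  have i6 : Integrable (fun v => 1 + κ * contrast K Δ j m v) (clusterLaw r) :=
    (integrable_const _).add (i4.const_mul κ)
  have key : ∫ v, Real.exp (κ * contrast K Δ j m v) ∂(clusterLaw r) ≤
      ∫ v, ((1 + κ * contrast K Δ j m v) +
        (clusterCount Δ j m v * expRemainder |κ| (size v.2.1).toReal +
        (∑ i ∈ (Finset.range K).erase j, clusterCount Δ i m v *
          expRemainder |κ| (size v.2.1).toReal) / (K - 1))) ∂(clusterLaw r) := by
    refine integral_mono_ae i3 (i6.add i5) ?_
    filter_upwards [hae] with v hv
    obtain ⟨h1, h2, h3⟩ := avg_clusterCount_mem hΔ hK hj m hv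
    refine (exp_le_one_add_add (lt_of_lt_of_le one_pos (one_le_size_toReal hv))
      (clusterCount_nonneg Δ j m v) h1 h3 h2).trans (le_of_eq ?_)
    rw [contrast, ← Finset.sum_mul]
    ring
  rw [integral_add i6 i5,
    integral_add (integrable_const _) (i4.const_mul κ), integral_const_mul,
    integral_add (i2 j) ((integrable_finsetSum _ fun i _ => i2 i).div_const _),
    integral_div, integral_finsetSum _ fun i _ => i2 i] at key
  have e4 : ∫ v, contrast K Δ j m v ∂(clusterLaw r) = meanContrast r K Δ j m := by
    unfold contrast
    rw [integral_sub (i1 j) ((integrable_finsetSum _ fun i _ => i1 i).div_const _),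
      integral_div, integral_finsetSum _ fun i _ => i1 i, meanContrast]
    simp_rw [e1]
  rw [e4] at key
  simp_rw [e2] at key
  rw [e3]
  simp only [integral_const, probReal_univ, smul_eq_mul, mul_one] at key
  linarith

/-- The linear terms cancel only in the sum over all blocks, whence the slack ε for large finite
`I`. The remainders cost Δρ for bin j and Δρ for the average of the other bins. -/
lemma eventually_sum_lintegral_exp_contrast_le (hr : r < 1) (hΔ : 0 < Δ) (hK : 2 ≤ K) (hρ : 0 ≤ ρ)
    (h : ∫⁻ c, expWeight |κ| (size c).toReal ∂(offspringLaw r) ≤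
      ENNReal.ofReal (1 + |κ| / (1 - r) + ρ)) {ε : ℝ} (hε : 0 < ε) :
    ∀ᶠ I : Finset ℤ in atTop, ∀ j < K, ∑ m ∈ I,
      ((∫⁻ v, ENNReal.ofReal (Real.exp (κ * contrast K Δ j m v)) ∂(clusterLaw r)).toReal - 1) ≤
      2 * Δ * ρ + ε := by
  have hle := lintegral_size_mul_expRemainder_le hr (abs_nonneg κ) h hρ
  have hfin := ne_top_of_le_ne_top (by simp) hle
  have hne := ne_top_of_le_ne_top (by simp) h
  have hK' : (0 : ℝ) < K - 1 := by
    have : (2 : ℝ) ≤ K := by exact_mod_cast hK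
    linarith
  have h1 : ∀ᶠ I : Finset ℤ in atTop, ∀ j ∈ Finset.range K,
      κ * ∑ m ∈ I, meanContrast r K Δ j m < ε := by
    rw [Filter.eventually_all_finset]
    intro j hj
    have := (hasSum_meanContrast hr hΔ hK (Finset.mem_range.1 hj)).mul_left κ
    rw [mul_zero] at this
    filter_upwards [this.eventually_lt_const hε] with I hI
    rwa [Finset.mul_sum]
  have h2 : ∀ i, ∀ I : Finset ℤ, ∑ m ∈ I,
      binMean r Δ (fun c => ENNReal.ofReal (expRemainder |κ| (size c).toReal)) i m ≤ Δ * ρ := by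
    intro i I
    refine (sum_le_hasSum I (fun m _ => binMean_nonneg _ _ _)
      (hasSum_binMean hΔ (by fun_prop) hfin i)).trans ?_
    gcongr
    exact ENNReal.toReal_le_of_le_ofReal hρ hle
  filter_upwards [h1] with I hI j hj
  refine (Finset.sum_le_sum fun m _ => lintegral_exp_contrast_le hr hΔ hK hne hfin hj m).trans ?_
  rw [Finset.sum_add_distrib, Finset.sum_add_distrib, ← Finset.mul_sum, ← Finset.sum_div,
    Finset.sum_comm]
  have h3 := hI j (Finset.mem_range.2 hj)
  have h4 := h2 j I
  have h5 : (∑ i ∈ (Finset.range K).erase j, ∑ m ∈ I,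
      binMean r Δ (fun c => ENNReal.ofReal (expRemainder |κ| (size c).toReal)) i m) /
      ((K : ℝ) - 1) ≤ Δ * ρ := by
    rw [div_le_iff₀ hK']
    refine (Finset.sum_le_sum fun i _ => h2 i I).trans (le_of_eq ?_)
    rw [Finset.sum_const, Finset.card_erase_of_mem (Finset.mem_range.2 hj), Finset.card_range,
      nsmul_eq_mul, Nat.cast_sub (by omega)]
    push_cast
    ring
  linarith

end Contrast

/-! ### Tail bounds for a cluster together with the other clusters in its bins -/

/-- The proportion of the observed events of a cluster in the `j`-th bin. -/
def binWeight (K : ℕ) (Δ : ℝ) (j : ℕ) (m : ℤ) (v : Cluster) : ℝ :=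
  clusterCount Δ j m v / ∑ i ∈ Finset.range K, clusterCount Δ i m v

/-- The contrast of the other clusters of the blocks `I`, averaged over the events of the
cluster `a`. -/
def restContrast (K : ℕ) (Δ : ℝ) (I : Finset ℤ) (ω : Source) (a : ℤ × ℕ) : ℝ :=
  ∑ j ∈ Finset.range K, binWeight K Δ j a.1 (cluster ω.2 a) *
    ∑ b ∈ (born I ω.1).erase a, contrast K Δ j b.1 (cluster ω.2 b)

@[fun_prop]
lemma measurable_binWeight (K : ℕ) (Δ : ℝ) (j : ℕ) (m : ℤ) : Measurable (binWeight K Δ j m) := by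
  unfold binWeight; fun_prop

lemma binWeight_nonneg (K : ℕ) (Δ : ℝ) (j : ℕ) (m : ℤ) (v : Cluster) :
    0 ≤ binWeight K Δ j m v :=
  div_nonneg (clusterCount_nonneg _ _ _ _)
    (Finset.sum_nonneg fun _ _ => clusterCount_nonneg _ _ _ _)

lemma sum_binWeight {Δ : ℝ} (hΔ : 0 < Δ) (K : ℕ) (m : ℤ) {v : Cluster} (h : size v.2.1 ≠ ∞)
    (hv : count (Set.Ioc 0 (K * Δ)) (m + v.1) v.2 ≠ 0) :
    ∑ j ∈ Finset.range K, binWeight K Δ j m v = 1 := by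
  simp_rw [binWeight]
  rw [← Finset.sum_div, div_self]
  rw [sum_clusterCount hΔ K m h]
  exact (ENNReal.toReal_pos hv (count_ne_top h)).ne'

open scoped Classical in
lemma sum_ofReal_binWeight_le {Δ : ℝ} (hΔ : 0 < Δ) (K : ℕ) (m : ℤ) {v : Cluster}
    (h : size v.2.1 ≠ ∞) :
    ∑ j ∈ Finset.range K, ENNReal.ofReal (binWeight K Δ j m v) ≤
      if count (Set.Ioc 0 (K * Δ)) (m + v.1) v.2 ≠ 0 then 1 else 0 := by
  rw [← ENNReal.ofReal_sum_of_nonneg fun _ _ => binWeight_nonneg _ _ _ _ _]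
  split_ifs with hv
  · rw [sum_binWeight hΔ K m h hv, ENNReal.ofReal_one]
  · simp_rw [binWeight]
    rw [← Finset.sum_div, sum_clusterCount hΔ K m h, not_not.1 hv]
    simp

/-- Jensen moves the average over bins out of the exponential. For each fixed bin the others then
enter as a product over clusters, the form the Mecke formula needs. -/
lemma ofReal_exp_le_sum {Δ : ℝ} (hΔ : 0 < Δ) {K : ℕ} {I : Finset ℤ} {ω : Source} {θ κ t : ℝ}
    {a : ℤ × ℕ} (ha : a ∈ born I ω.1) (hs : size (cluster ω.2 a).2.1 ≠ ∞)
    (hc : count (Set.Ioc 0 (K * Δ)) (a.1 + (cluster ω.2 a).1) (cluster ω.2 a).2 ≠ 0)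
    (ht : t ≤ θ * (size (cluster ω.2 a).2.1).toReal + κ * restContrast K Δ I ω a) :
    ENNReal.ofReal (Real.exp t) ≤ ∑ j ∈ Finset.range K, ∑ a ∈ born I ω.1,
      (ENNReal.ofReal (binWeight K Δ j a.1 (cluster ω.2 a)) *
        expWeight θ (size (cluster ω.2 a).2.1).toReal) *
      ∏ b ∈ (born I ω.1).erase a,
        ENNReal.ofReal (Real.exp (κ * contrast K Δ j b.1 (cluster ω.2 b))) := by
  have h1 : ∀ j, ENNReal.ofReal (Real.exp (κ * ∑ b ∈ (born I ω.1).erase a,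
      contrast K Δ j b.1 (cluster ω.2 b))) = ∏ b ∈ (born I ω.1).erase a,
        ENNReal.ofReal (Real.exp (κ * contrast K Δ j b.1 (cluster ω.2 b))) := fun j => by
    rw [← ENNReal.ofReal_prod_of_nonneg (fun _ _ => by positivity), ← Real.exp_sum,
      Finset.mul_sum]
  have h2 := convexOn_exp.map_sum_le (t := Finset.range K)
    (w := fun j => binWeight K Δ j a.1 (cluster ω.2 a))
    (p := fun j => κ * ∑ b ∈ (born I ω.1).erase a, contrast K Δ j b.1 (cluster ω.2 b))
    (fun _ _ => binWeight_nonneg _ _ _ _ _) (sum_binWeight hΔ K a.1 hs hc)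
    (fun _ _ => Set.mem_univ _)
  have h3 : ∑ j ∈ Finset.range K, binWeight K Δ j a.1 (cluster ω.2 a) •
      (κ * ∑ b ∈ (born I ω.1).erase a, contrast K Δ j b.1 (cluster ω.2 b)) =
      κ * restContrast K Δ I ω a := by
    rw [restContrast, Finset.mul_sum]
    refine Finset.sum_congr rfl fun j _ => ?_
    rw [smul_eq_mul]
    ring
  rw [h3] at h2
  calc ENNReal.ofReal (Real.exp t)
      ≤ ENNReal.ofReal (Real.exp (θ * (size (cluster ω.2 a).2.1).toReal) *
        ∑ j ∈ Finset.range K, binWeight K Δ j a.1 (cluster ω.2 a) *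
          Real.exp (κ * ∑ b ∈ (born I ω.1).erase a, contrast K Δ j b.1 (cluster ω.2 b))) := by
        refine ENNReal.ofReal_le_ofReal ((Real.exp_le_exp.2 ht).trans ?_)
        rw [Real.exp_add]
        gcongr
        simpa using h2
    _ = ∑ j ∈ Finset.range K, (ENNReal.ofReal (binWeight K Δ j a.1 (cluster ω.2 a)) *
        expWeight θ (size (cluster ω.2 a).2.1).toReal) * ∏ b ∈ (born I ω.1).erase a,
        ENNReal.ofReal (Real.exp (κ * contrast K Δ j b.1 (cluster ω.2 b))) := by
        rw [Finset.mul_sum, ENNReal.ofReal_sum_of_nonneg fun j _ => by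
          have := binWeight_nonneg K Δ j a.1 (cluster ω.2 a)
          positivity]
        refine Finset.sum_congr rfl fun j _ => ?_
        rw [← h1, expWeight, ENNReal.ofReal_mul (by positivity),
          ENNReal.ofReal_mul (binWeight_nonneg _ _ _ _ _)]
        ring
    _ ≤ _ := by
        refine Finset.sum_le_sum fun j _ => ?_
        exact Finset.single_le_sum (f := fun a : ℤ × ℕ =>
          (ENNReal.ofReal (binWeight K Δ j a.1 (cluster ω.2 a)) *
            expWeight θ (size (cluster ω.2 a).2.1).toReal) * ∏ b ∈ (born I ω.1).erase a,
          ENNReal.ofReal (Real.exp (κ * contrast K Δ j b.1 (cluster ω.2 b))))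
          (fun _ _ => zero_le) ha

/-- Some observed cluster of the blocks `I` has a large value of `θ * N + κ * Z`, where `N` is its
size and `Z` the contrast of the other clusters in its bins. -/
def tailEvent (K : ℕ) (Δ θ κ t : ℝ) (I : Finset ℤ) : Set Source :=
  {ω | ∃ a ∈ born I ω.1, size (cluster ω.2 a).2.1 ≠ ∞ ∧
    count (Set.Ioc 0 (K * Δ)) (a.1 + (cluster ω.2 a).1) (cluster ω.2 a).2 ≠ 0 ∧
    t ≤ θ * (size (cluster ω.2 a).2.1).toReal + κ * restContrast K Δ I ω a}

/-- Markov's inequality for the sum in `ofReal_exp_le_sum`. The bin weights of a cluster add up to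
at most the indicator that it is observed, so summing over bins brings no factor K. -/
lemma eventually_measure_tailEvent_le {μ α Δ ρ θ κ t A : ℝ} {K : ℕ}
    (hα : 0 ≤ α) (hα1 : α < 1) (hΔ : 0 < Δ) (hK : 2 ≤ K) (hρ : 0 ≤ ρ)
    (h : ∫⁻ c, expWeight |κ| (size c).toReal ∂(offspringLaw α.toNNReal) ≤
      ENNReal.ofReal (1 + |κ| / (1 - α) + ρ))
    (hA : ENNReal.ofReal (K * Δ) *
        ∫⁻ c, expWeight θ (size c).toReal ∂(offspringLaw α.toNNReal) +
      ∫⁻ c, (size c - 1) * expWeight θ (size c).toReal ∂(offspringLaw α.toNNReal) ≤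
      ENNReal.ofReal A) (hμ : 0 ≤ μ) {ε : ℝ} (hε : 0 < ε) :
    ∀ᶠ I : Finset ℤ in atTop, sourceLaw μ α (tailEvent K Δ θ κ t I) ≤
      ENNReal.ofReal (μ * A * Real.exp (2 * μ * Δ * ρ - t + μ * ε)) := by
  classical
  have hr : α.toNNReal < 1 := by
    rw [← NNReal.coe_lt_coe, Real.coe_toNNReal α hα]
    exact hα1
  have hαc : (α.toNNReal : ℝ) = α := Real.coe_toNNReal α hα
  have hev := eventually_sum_lintegral_exp_contrast_le (κ := κ) hr hΔ hK hρ (by rwa [hαc]) hε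
  filter_upwards [hev] with I hI
  set g : ℕ → ℤ → Cluster → ℝ≥0∞ := fun j m v =>
    ENNReal.ofReal (Real.exp (κ * contrast K Δ j m v)) with hg
  set f : ℕ → ℤ → Cluster → ℝ≥0∞ := fun j m v =>
    ENNReal.ofReal (binWeight K Δ j m v) * expWeight θ (size v.2.1).toReal with hf
  have mg : ∀ j m, Measurable (g j m) := fun j m => by fun_prop
  have mf : ∀ j m, Measurable (f j m) := fun j m => by fun_prop
  have hfin : ∀ j < K, ∀ m, ∫⁻ v, g j m v ∂(clusterLaw α.toNNReal) ≠ ∞ := fun j hj m =>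
    lintegral_exp_contrast_ne_top hr hΔ hK (ne_top_of_le_ne_top (by simp) h) hj m
  have mW : ∀ j, Measurable fun ω : Source => ∑ a ∈ born I ω.1, f j a.1 (cluster ω.2 a) *
        ∏ b ∈ (born I ω.1).erase a, g j b.1 (cluster ω.2 b) := fun j =>
    measurable_born (F := fun B (ω : Source) => ∑ a ∈ B, f j a.1 (cluster ω.2 a) *
        ∏ b ∈ B.erase a, g j b.1 (cluster ω.2 b)) (by fun_prop) fun B => by
      refine Finset.measurable_fun_sum _ fun a _ => Measurable.mul
        ((mf j a.1).comp (f := fun ω : Source => cluster ω.2 a) (by fun_prop))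
        (Finset.measurable_fun_prod _ fun b _ =>
          (mg j b.1).comp (f := fun ω : Source => cluster ω.2 b) (by fun_prop))
  have h1 : ENNReal.ofReal (Real.exp t) * sourceLaw μ α (tailEvent K Δ θ κ t I) ≤
      ∫⁻ ω, ∑ j ∈ Finset.range K, ∑ a ∈ born I ω.1, f j a.1 (cluster ω.2 a) *
        ∏ b ∈ (born I ω.1).erase a, g j b.1 (cluster ω.2 b) ∂(sourceLaw μ α) := by
    refine le_trans ?_ (mul_meas_ge_le_lintegral
      (Finset.measurable_fun_sum _ fun j _ => mW j) (ENNReal.ofReal (Real.exp t)))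
    refine mul_le_mul' le_rfl (measure_mono ?_)
    rintro ω ⟨a, ha, hs, hc, ht⟩
    exact ofReal_exp_le_sum hΔ ha hs hc ht
  have h2 : ∀ j ∈ Finset.range K, ∫⁻ ω, ∑ a ∈ born I ω.1, f j a.1 (cluster ω.2 a) *
        ∏ b ∈ (born I ω.1).erase a, g j b.1 (cluster ω.2 b) ∂(sourceLaw μ α) ≤
      (∑ m ∈ I, ∫⁻ v, f j m v ∂(clusterLaw α.toNNReal)) *
        ENNReal.ofReal (μ * Real.exp (μ * (2 * Δ * ρ + ε))) := by
    intro j hj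
    rw [lintegral_sum_mul_prod_cluster μ α I (mf j) (mg j)
      (γ := fun m => (∫⁻ v, g j m v ∂(clusterLaw α.toNNReal)).toNNReal)
      fun m => (ENNReal.coe_toNNReal (hfin j (Finset.mem_range.1 hj) m)).symm]
    gcongr
    rw [ENNReal.ofReal_mul hμ]
    refine mul_le_mul' le_rfl (ENNReal.ofReal_le_ofReal (Real.exp_le_exp.2 ?_))
    rw [← Finset.mul_sum, Real.coe_toNNReal μ hμ]
    gcongr
    exact hI j (Finset.mem_range.1 hj)
  have h3 : ∑ j ∈ Finset.range K, ∑ m ∈ I, ∫⁻ v, f j m v ∂(clusterLaw α.toNNReal) ≤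
      ENNReal.ofReal A := by
    refine le_trans ?_ ((tsum_lintegral_count_ne_zero_le hr (K * Δ)
      (h := fun c => expWeight θ (size c).toReal) (by fun_prop)).trans hA)
    refine le_trans ?_ (ENNReal.sum_le_tsum I)
    rw [Finset.sum_comm]
    refine Finset.sum_le_sum fun m _ => ?_
    rw [← lintegral_finsetSum _ fun j _ => mf j m]
    refine lintegral_mono_ae ?_
    filter_upwards [(measurePreserving_offspring _).quasiMeasurePreserving.ae (ae_size_ne_top hr)]
      with v hv
    rw [hf, ← Finset.sum_mul]
    gcongr
    exact sum_ofReal_binWeight_le hΔ K m hv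
  have h4 : ENNReal.ofReal (Real.exp t) * sourceLaw μ α (tailEvent K Δ θ κ t I) ≤
      ENNReal.ofReal A * ENNReal.ofReal (μ * Real.exp (μ * (2 * Δ * ρ + ε))) := by
    refine h1.trans ?_
    rw [lintegral_finsetSum _ fun j _ => mW j]
    refine (Finset.sum_le_sum h2).trans ?_
    rw [← Finset.sum_mul]
    gcongr
  calc sourceLaw μ α (tailEvent K Δ θ κ t I)
      = ENNReal.ofReal (Real.exp (-t)) * (ENNReal.ofReal (Real.exp t) *
          sourceLaw μ α (tailEvent K Δ θ κ t I)) := by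
        rw [← mul_assoc, ← ENNReal.ofReal_mul (by positivity), ← Real.exp_add]
        simp
    _ ≤ ENNReal.ofReal (Real.exp (-t)) * (ENNReal.ofReal A *
          ENNReal.ofReal (μ * Real.exp (μ * (2 * Δ * ρ + ε)))) := by gcongr
    _ = _ := by
        rw [mul_left_comm, ← ENNReal.ofReal_mul (by positivity), mul_comm,
          ← ENNReal.ofReal_mul (by positivity)]
        congr 1
        rw [show 2 * μ * Δ * ρ - t + μ * ε = -t + μ * (2 * Δ * ρ + ε) by ring, Real.exp_add]
        ring

/-! ### The Laplace mechanism -/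

lemma laplace_le {m m' b ε : ℝ} (hb : 0 < b) (h : |m - m'| ≤ b * ε) :
    laplace m b ≤ ENNReal.ofReal (Real.exp ε) • laplace m' b := by
  unfold laplace
  rw [← withDensity_smul _ (by fun_prop)]
  refine withDensity_mono (ae_of_all _ fun x => ?_)
  rw [Pi.smul_apply, smul_eq_mul, ← ENNReal.ofReal_mul (by positivity)]
  refine ENNReal.ofReal_le_ofReal ?_
  rw [← mul_div_assoc, ← Real.exp_add]
  gcongr
  have h1 : |x - m'| ≤ |x - m| + |m - m'| := by
    simpa using abs_sub_le x m m'
  rw [neg_div, neg_div, neg_le, neg_add, neg_neg, ← sub_eq_neg_add, sub_le_iff_le_add,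
    div_add' _ _ _ hb.ne']
  gcongr
  linarith

lemma indistinguishable_iff {Y : Type*} [MeasurableSpace Y] {ε : ℝ} {ν ν' : Measure Y} :
    Indistinguishable ε ν ν' ↔ ν ≤ ENNReal.ofReal (Real.exp ε) • ν' ∧
      ν' ≤ ENNReal.ofReal (Real.exp ε) • ν := by
  simp only [Indistinguishable, Measure.le_iff, Measure.smul_apply, smul_eq_mul]
  exact ⟨fun h => ⟨fun s hs => (h s hs).1, fun s hs => (h s hs).2⟩,
    fun h s hs => ⟨h.1 s hs, h.2 s hs⟩⟩

lemma indistinguishable_laplace {m m' b ε : ℝ} (hb : 0 < b) (h : |m - m'| ≤ b * ε) :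
    Indistinguishable ε (laplace m b) (laplace m' b) :=
  indistinguishable_iff.2 ⟨laplace_le hb h, laplace_le hb (by rwa [abs_sub_comm])⟩

instance (m b : ℝ) : SFinite (laplace m b) := by unfold laplace; infer_instance

/-- Composition of independent mechanisms followed by post-processing: the density factors multiply,
and a measurable map preserves domination of measures. -/
lemma Indistinguishable.prod_map {Y Y' Z : Type*} [MeasurableSpace Y] [MeasurableSpace Y']
    [MeasurableSpace Z] {ε ε' : ℝ} {ν₁ ν₂ : Measure Y} {ν₁' ν₂' : Measure Y'}
    [SFinite ν₁] [SFinite ν₂] [SFinite ν₁'] [SFinite ν₂']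
    (h : Indistinguishable ε ν₁ ν₂) (h' : Indistinguishable ε' ν₁' ν₂') {f : Y × Y' → Z}
    (hf : Measurable f) :
    Indistinguishable (ε + ε') ((ν₁.prod ν₁').map f) ((ν₂.prod ν₂').map f) := by
  rw [indistinguishable_iff] at h h' ⊢
  have key : ∀ {σ₁ σ₂ : Measure Y} {σ₁' σ₂' : Measure Y'} [SFinite σ₁] [SFinite σ₂] [SFinite σ₁']
      [SFinite σ₂'], σ₁ ≤ ENNReal.ofReal (Real.exp ε) • σ₂ →
      σ₁' ≤ ENNReal.ofReal (Real.exp ε') • σ₂' →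
      (σ₁.prod σ₁').map f ≤ ENNReal.ofReal (Real.exp (ε + ε')) • (σ₂.prod σ₂').map f := by
    intro σ₁ σ₂ σ₁' σ₂' _ _ _ _ h1 h2
    have h3 := Measure.map_mono (Measure.prod_mono h1 h2) hf
    rw [Measure.prod_smul_left, Measure.prod_smul_right, smul_smul,
      Measure.map_smul, ← ENNReal.ofReal_mul (by positivity), ← Real.exp_add] at h3
    exact h3
  exact ⟨key h.1 h'.1, key h.2 h'.2⟩

/-! ### Sensitivity of the sample variance -/

/-- The contrast of `R` averaged with the weights `d / ∑ d`. -/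
def avgContrast (K : ℕ) (d R : ℕ → ℝ) : ℝ :=
  ∑ j ∈ Finset.range K, d j / (∑ i ∈ Finset.range K, d i) *
    (R j - (∑ i ∈ (Finset.range K).erase j, R i) / ((K : ℝ) - 1))

/-- The change is (D - N²/K)/(K-1) + 2NZ/K with D = ∑d². Since N²/K ≤ D ≤ N², the first term lies
between 0 and N²/K, so only N² + 2NZ and -2NZ need upper bounds. -/
lemma abs_variance_sub_le {K : ℕ} (hK : 2 ≤ K) {d R : ℕ → ℝ} {N n s : ℝ} (hd : ∀ i, 0 ≤ d i)
    (hN : ∑ i ∈ Finset.range K, d i = N) (hN0 : 0 < N) (hs : 0 ≤ s) (h1 : N ≤ n)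
    (h2 : N + avgContrast K d R ≤ n + s) (h3 : N - avgContrast K d R ≤ n + s) :
    |(∑ i ∈ Finset.range K, (R i + d i - (∑ i ∈ Finset.range K, (R i + d i)) / K) ^ 2) /
        ((K : ℝ) - 1) -
      (∑ i ∈ Finset.range K, (R i - (∑ i ∈ Finset.range K, R i) / K) ^ 2) / ((K : ℝ) - 1)| ≤
    (n ^ 2 + 2 * n * s * (K / ((K : ℝ) - 1))) / K := by
  have hK2 : (2 : ℝ) ≤ K := by exact_mod_cast hK
  have hK0 : (0 : ℝ) < K := by linarith
  have hK1 : (0 : ℝ) < K - 1 := by linarith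
  set Z := avgContrast K d R with hZ
  set r := ∑ i ∈ Finset.range K, R i with hr
  have hNZ : N * Z = ∑ j ∈ Finset.range K, d j * (R j - (r - R j) / (K - 1)) := by
    rw [hZ, avgContrast, Finset.mul_sum]
    refine Finset.sum_congr rfl fun j hj => ?_
    rw [hN, ← mul_assoc, mul_div_cancel₀ _ hN0.ne', Finset.sum_erase_eq_sub hj]
  have hNZ' : N * Z * ((K - 1) / K) = ∑ j ∈ Finset.range K, d j * R j - N * r / K := by
    rw [hNZ, Finset.sum_mul, ← hN, Finset.sum_mul, Finset.sum_div, ← Finset.sum_sub_distrib]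
    refine Finset.sum_congr rfl fun j _ => ?_
    field_simp
    ring
  have expand : ∀ Y : ℕ → ℝ, ∑ i ∈ Finset.range K, (Y i - (∑ i ∈ Finset.range K, Y i) / K) ^ 2 =
      ∑ i ∈ Finset.range K, Y i ^ 2 - (∑ i ∈ Finset.range K, Y i) ^ 2 / K := by
    intro Y
    set y := ∑ i ∈ Finset.range K, Y i with hy
    have : ∀ i, (Y i - y / K) ^ 2 = Y i ^ 2 - 2 * (y / K) * Y i + (y / K) ^ 2 := fun i => by ring
    simp_rw [this]
    rw [Finset.sum_add_distrib, Finset.sum_sub_distrib, ← Finset.mul_sum, ← hy, Finset.sum_const,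
      Finset.card_range, nsmul_eq_mul]
    field_simp
    ring
  have hsq : ∑ i ∈ Finset.range K, (R i + d i) ^ 2 = ∑ i ∈ Finset.range K, R i ^ 2 +
      2 * ∑ i ∈ Finset.range K, d i * R i + ∑ i ∈ Finset.range K, d i ^ 2 := by
    rw [Finset.mul_sum, ← Finset.sum_add_distrib, ← Finset.sum_add_distrib]
    exact Finset.sum_congr rfl fun i _ => by ring
  set D := ∑ i ∈ Finset.range K, d i ^ 2 with hD
  have hD1 : D ≤ N ^ 2 := by
    rw [← hN]
    exact Finset.sum_sq_le_sq_sum_of_nonneg fun i _ => hd i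
  have hD2 : N ^ 2 / K ≤ D := by
    rw [div_le_iff₀ hK0, ← hN]
    have := sq_sum_le_card_mul_sum_sq (s := Finset.range K) (f := d)
    rw [Finset.card_range] at this
    linarith
  have hdiff : (∑ i ∈ Finset.range K, (R i + d i - (∑ i ∈ Finset.range K, (R i + d i)) / K) ^ 2) /
        ((K : ℝ) - 1) -
      (∑ i ∈ Finset.range K, (R i - r / K) ^ 2) / ((K : ℝ) - 1) =
      (D - N ^ 2 / K) / (K - 1) + 2 * (N * Z) / K := by
    rw [expand (fun i => R i + d i), expand R, hsq, Finset.sum_add_distrib, hN, ← hr]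
    have : ∑ j ∈ Finset.range K, d j * R j = N * Z * ((K - 1) / K) + N * r / K := by linarith
    rw [this]
    field_simp
    ring
  rw [hdiff]
  have hA0 : 0 ≤ (D - N ^ 2 / K) / (K - 1) := div_nonneg (by linarith) hK1.le
  have hA1 : (D - N ^ 2 / K) / (K - 1) ≤ N ^ 2 / K := by
    rw [div_le_iff₀ hK1]
    calc D - N ^ 2 / K ≤ N ^ 2 - N ^ 2 / K := by linarith
      _ = N ^ 2 / K * (K - 1) := by field_simp
  have hs' : s ≤ s * (K / ((K : ℝ) - 1)) := by
    apply le_mul_of_one_le_right hs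
    rw [one_le_div hK1]
    linarith
  have hns : 2 * n * s ≤ 2 * n * s * (K / ((K : ℝ) - 1)) := by
    have : 0 ≤ 2 * n := by linarith
    rw [mul_assoc (2 * n)]
    gcongr
  -- Inserting Z ≤ n + s - N gives 2N(n+s) - N² = n² - (n-N)² + 2Ns, and N ≤ n.
  have hup : N ^ 2 + 2 * (N * Z) ≤ n ^ 2 + 2 * n * s := by
    nlinarith [mul_nonneg hN0.le (sub_nonneg.2 h2), mul_nonneg (sub_nonneg.2 h1) hs,
      sq_nonneg (n - N)]
  have hlo : -(n ^ 2 + 2 * n * s) ≤ 2 * (N * Z) := by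
    nlinarith [mul_nonneg hN0.le (sub_nonneg.2 h3), mul_nonneg (sub_nonneg.2 h1) hs,
      sq_nonneg (n - N), sq_nonneg N]
  rw [abs_le]
  constructor
  · rw [neg_le_iff_add_nonneg]
    have : 0 ≤ (2 * (N * Z) + (n ^ 2 + 2 * n * s * (K / ((K : ℝ) - 1)))) / K :=
      div_nonneg (by linarith) hK0.le
    rw [add_div] at this
    linarith
  · calc (D - N ^ 2 / K) / (K - 1) + 2 * (N * Z) / K ≤ N ^ 2 / K + 2 * (N * Z) / K := by gcongr
      _ = (N ^ 2 + 2 * (N * Z)) / K := by ring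
      _ ≤ _ := div_le_div_of_nonneg_right (by linarith) hK0.le

/-! ### The observed counts as sums over clusters -/

lemma isBorn_iff (ω : Source) (n : ℤ) (k : ℕ) (p : List ℕ) :
    IsBorn ω n k p ↔ k < ω.1 n ∧ Alive (cluster ω.2 (n, k)).2.1 p := by
  induction p with
  | nil => simp [IsBorn, Alive]
  | cons j p ih => simp [IsBorn, Alive, ih, cluster, and_assoc]

lemma birthTime_eq (ω : Source) (n : ℤ) (k : ℕ) (p : List ℕ) :
    birthTime ω n k p = n + (cluster ω.2 (n, k)).1 + age (cluster ω.2 (n, k)).2.2 p := by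
  induction p with
  | nil => simp [birthTime, age, cluster]
  | cons j p ih => rw [birthTime, ih, age, ← add_assoc]; rfl

/-- No finiteness is needed: for an infinite set `ncard` is 0 and the sum is ∞, whose `toReal` is 0
as well. -/
lemma ncard_eq_toReal_tsum {ι : Type*} (P : ι → Prop) [DecidablePred P] :
    (Set.ncard {i | P i} : ℝ) = (∑' i, if P i then (1 : ℝ≥0∞) else 0).toReal := by
  have h : (∑' i, if P i then (1 : ℝ≥0∞) else 0) = ({i | P i} : Set ι).encard := by
    rw [← ENNReal.tsum_set_one, tsum_subtype {i | P i} (fun _ => (1 : ℝ≥0∞))]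
    refine tsum_congr fun i => ?_
    simp [Set.indicator_apply]
  rw [h]
  by_cases hf : ({i | P i} : Set ι).Finite
  · rw [← hf.cast_ncard_eq]
    simp
  · rw [Set.Infinite.ncard hf, Set.encard_eq_top_iff.2 hf]
    simp

open scoped Classical in
/-- If the clusters of the blocks outside `I` are not observed, the number of observed events in
`B` of the clusters selected by `Q` is a finite sum. -/
lemma ncard_observed {T : ℝ} {ω : Source} {I : Finset ℤ} {B : Set ℝ} (hB : B ⊆ Set.Ioc 0 T)
    (hI : ∀ a : ℤ × ℕ, a.1 ∉ I → a.2 < ω.1 a.1 →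
      count (Set.Ioc 0 T) (a.1 + (cluster ω.2 a).1) (cluster ω.2 a).2 = 0)
    (Q : ℤ × ℕ → Prop) :
    (Set.ncard {e ∈ observed T ω | Q (e.1.1, e.1.2.1) ∧ e.2 ∈ B} : ℝ) =
      (∑ a ∈ (born I ω.1).filter Q,
        count B (a.1 + (cluster ω.2 a).1) (cluster ω.2 a).2).toReal := by
  set F : Label → Event := fun l => (l, birthTime ω l.1 l.2.1 l.2.2) with hF
  have hinj : Function.Injective F := fun l l' h => (Prod.ext_iff.1 h).1
  have himg : {e ∈ observed T ω | Q (e.1.1, e.1.2.1) ∧ e.2 ∈ B} =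
      F '' {l | IsBorn ω l.1 l.2.1 l.2.2 ∧ birthTime ω l.1 l.2.1 l.2.2 ∈ B ∧ Q (l.1, l.2.1)} := by
    ext ⟨l, t⟩
    constructor
    · rintro ⟨⟨h1, h2, h3, h4⟩, h5, h6⟩
      have h2' : t = birthTime ω l.1 l.2.1 l.2.2 := h2
      subst h2'
      exact ⟨l, ⟨h1, h6, h5⟩, rfl⟩
    · rintro ⟨l', ⟨h1, h2, h3⟩, h4⟩
      obtain ⟨rfl, rfl⟩ := Prod.ext_iff.1 h4
      exact ⟨⟨h1, rfl, (hB h2).1, (hB h2).2⟩, h3, h2⟩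
  rw [himg, Set.ncard_image_of_injective _ hinj, ncard_eq_toReal_tsum]
  congr 1
  rw [← (Equiv.prodAssoc ℤ ℕ (List ℕ)).tsum_eq, ENNReal.tsum_prod',
    tsum_eq_sum (s := (born I ω.1).filter Q)]
  · refine Finset.sum_congr rfl fun a ha => tsum_congr fun p => ?_
    rw [Finset.mem_filter, mem_born] at ha
    simp only [Equiv.prodAssoc_apply, isBorn_iff, birthTime_eq, ha, true_and, and_true]
  · intro a ha
    rw [Finset.mem_filter, mem_born] at ha
    rw [ENNReal.tsum_eq_zero]
    intro p
    rw [if_neg]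
    rintro ⟨h1, h2, h3⟩
    rw [isBorn_iff] at h1
    by_cases ha' : a.1 ∈ I
    · exact ha ⟨⟨ha', h1.1⟩, h3⟩
    · have := ENNReal.tsum_eq_zero.1 (hI a ha' h1.1) p
      rw [if_pos ⟨h1.2, hB (by rw [← birthTime_eq]; exact h2)⟩] at this
      exact one_ne_zero this

/-! ### Numerical estimates -/

lemma exp_sub_sq_le {x : ℝ} (hx : 0 ≤ x) : Real.exp (x - x ^ 2 / 2) ≤ 1 + x := by
  rw [← Real.le_log_iff_exp_le (by linarith)]
  refine le_trans ?_ (Real.le_log_one_add_of_nonneg hx)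
  rw [le_div_iff₀ (by linarith)]
  nlinarith [pow_nonneg hx 3]

/-- The tail bounds apply with the exponent `θ = x * (1 - α) - x ^ 2 / 2`. -/
lemma exponential_moments {α x T : ℝ} (hα : 0 < α) (hα1 : α < 1) (hx : 0 ≤ x) (hT : 0 ≤ T)
    (hxα : α * (1 + x) < 1) :
    ∫⁻ c, expWeight (x * (1 - α) - x ^ 2 / 2) (size c).toReal ∂(offspringLaw α.toNNReal) ≤
        ENNReal.ofReal (1 + (x * (1 - α) - x ^ 2 / 2) / (1 - α) + x ^ 2 / (2 * (1 - α))) ∧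
      ENNReal.ofReal T *
          ∫⁻ c, expWeight (x * (1 - α) - x ^ 2 / 2) (size c).toReal ∂(offspringLaw α.toNNReal) +
        ∫⁻ c, (size c - 1) * expWeight (x * (1 - α) - x ^ 2 / 2) (size c).toReal
          ∂(offspringLaw α.toNNReal) ≤
        ENNReal.ofReal (T * (1 + x) + α * (1 + x) ^ 2 / (1 - α * (1 + x))) := by
  have hr : α.toNNReal < 1 := by
    rw [← NNReal.coe_lt_coe, Real.coe_toNNReal α hα.le]
    exact hα1
  have hαc : (α.toNNReal : ℝ) = α := Real.coe_toNNReal α hα.le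
  have hp : 0 < 1 - α := by linarith
  have hd : 0 < 1 - α * (1 + x) := by linarith
  have hexp : Real.exp (x * (1 - α) - x ^ 2 / 2 + (α.toNNReal : ℝ) * (1 + x - 1)) ≤ 1 + x := by
    rw [hαc]
    refine le_trans (le_of_eq ?_) (exp_sub_sq_le hx)
    congr 1
    ring
  have h1 := lintegral_expWeight_size_le hr (by linarith : 1 ≤ 1 + x) hexp
  have h2 := lintegral_size_mul_expWeight_le hr (by linarith : 1 ≤ 1 + x) hexp (by rwa [hαc])
  rw [hαc] at h2
  constructor
  · refine h1.trans (ENNReal.ofReal_le_ofReal (le_of_eq ?_))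
    field_simp
    ring
  · rw [ENNReal.ofReal_add (by positivity) (by positivity), ENNReal.ofReal_mul hT]
    gcongr

/-- The first term is at most 9T/5, the second at most 8T/5. For α ≤ 27/100 the latter follows from
T > 1; for larger α the factor 1/(1-α) is absorbed by T > 10α²/(1-α). The constant 1.584 is 9/5 -
(4/5)(27/100). -/
lemma prefactor_le {α x T : ℝ} (hα : 0 < α) (hα1 : α < 1) (hx : 0 ≤ x)
    (hx1 : x ≤ 4 / 5 * (1 - α)) (hT : 1 < T) (hTα : 10 * α ^ 2 / (1 - α) < T) :
    T * (1 + x) + α * (1 + x) ^ 2 / (1 - α * (1 + x)) ≤ 17 / 5 * T := by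
  have hp : 0 < 1 - α := by linarith
  have hq : 0 < 1 - 4 / 5 * α := by linarith
  have hG : 1 + x ≤ 9 / 5 - 4 / 5 * α := by linarith
  have hden : (1 - α) * (1 - 4 / 5 * α) ≤ 1 - α * (1 + x) := by nlinarith
  have hJ : α * (1 + x) ^ 2 / (1 - α * (1 + x)) ≤
      α * (9 / 5 - 4 / 5 * α) ^ 2 / ((1 - α) * (1 - 4 / 5 * α)) := by
    have : 0 < (1 - α) * (1 - 4 / 5 * α) := by positivity
    gcongr
  rcases le_or_gt α (27 / 100) with h | h
  · have hJ' : α * (9 / 5 - 4 / 5 * α) ^ 2 / ((1 - α) * (1 - 4 / 5 * α)) ≤ 8 / 5 := by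
      rw [div_le_iff₀ (by positivity)]
      have h1 : (9 / 5 - 4 / 5 * α) ^ 2 ≤ 81 / 25 := by nlinarith
      have h2 : (73 / 100 : ℝ) * (98 / 125) ≤ (1 - α) * (1 - 4 / 5 * α) := by
        apply mul_le_mul <;> linarith
      have h3 : α * (9 / 5 - 4 / 5 * α) ^ 2 ≤ 27 / 100 * (81 / 25) := by gcongr
      linarith
    nlinarith
  · have hTp : 10 * α ^ 2 < T * (1 - α) := (div_lt_iff₀ hp).1 hTα
    have hJ' : α * (9 / 5 - 4 / 5 * α) ^ 2 / ((1 - α) * (1 - 4 / 5 * α)) ≤ 8 / 5 * T := by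
      rw [div_le_iff₀ (by positivity)]
      have h1 : (9 / 5 - 4 / 5 * α) ^ 2 ≤ (1.584 : ℝ) ^ 2 := by
        apply pow_le_pow_left₀ <;> linarith
      have h2 : (1 / 5 : ℝ) ≤ α * (1 - 4 / 5 * α) := by nlinarith
      have h3 : 10 * α * (1 / 5) ≤ 10 * α * (α * (1 - 4 / 5 * α)) := by gcongr
      have h4 : 10 * α ^ 2 * (1 - 4 / 5 * α) ≤ T * (1 - α) * (1 - 4 / 5 * α) := by gcongr
      have h5 : α * (9 / 5 - 4 / 5 * α) ^ 2 ≤ α * (1.584 : ℝ) ^ 2 := by gcongr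
      nlinarith
    nlinarith

/-- T·T^(-36/25) ≤ T^(-2/5) ≤ γ/(μe²), and 17/5 divided by e² is at most 1/2. This leaves γ/2, times
the slack factor 7/6. -/
lemma tail_numeric {μ α γ x T t τ : ℝ} (hμ : 0 < μ) (hα : 0 < α) (hα1 : α < 1) (hγ : 0 < γ)
    (hx : 0 ≤ x) (hx1 : x ≤ 4 / 5 * (1 - α)) (hT : 1 < T) (hTα : 10 * α ^ 2 / (1 - α) < T)
    (hTγ : (μ * Real.exp 2 / γ) ^ (5 / 2 : ℝ) ≤ T) (ht : 36 / 25 * Real.log T ≤ t)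
    (hτ1 : Real.exp τ ≤ 7 / 6) :
    μ * (T * (1 + x) + α * (1 + x) ^ 2 / (1 - α * (1 + x))) * Real.exp (-t + τ) ≤
      7 / 12 * γ := by
  have hT0 : 0 < T := by linarith
  have hA := prefactor_le hα hα1 hx hx1 hT hTα
  have h1 : μ * Real.exp 2 ≤ γ * T ^ (2 / 5 : ℝ) := by
    have := Real.rpow_le_rpow (by positivity) hTγ (by norm_num : (0 : ℝ) ≤ 2 / 5)
    rw [← Real.rpow_mul (by positivity)] at this
    norm_num at this
    rwa [div_le_iff₀ hγ, mul_comm (T ^ (2 / 5 : ℝ))] at this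
  have h2 : Real.exp (-t) ≤ T ^ (-(36 / 25) : ℝ) := by
    rw [Real.rpow_def_of_pos hT0, Real.exp_le_exp]
    linarith
  have h3 : T * T ^ (-(36 / 25) : ℝ) * T ^ (2 / 5 : ℝ) ≤ 1 := by
    nth_rewrite 1 [← Real.rpow_one T]
    rw [← Real.rpow_add hT0, ← Real.rpow_add hT0]
    exact Real.rpow_le_one_of_one_le_of_nonpos hT.le (by norm_num)
  have h4 : (34 / 5 : ℝ) ≤ Real.exp 2 := by
    have := Real.exp_one_gt_d9
    rw [show (2 : ℝ) = 1 + 1 by norm_num, Real.exp_add]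
    nlinarith
  have h5 : μ * (17 / 5 * T) * T ^ (-(36 / 25) : ℝ) * Real.exp 2 ≤ 17 / 5 * γ := by
    calc μ * (17 / 5 * T) * T ^ (-(36 / 25) : ℝ) * Real.exp 2
        = 17 / 5 * (T * T ^ (-(36 / 25) : ℝ)) * (μ * Real.exp 2) := by ring
      _ ≤ 17 / 5 * (T * T ^ (-(36 / 25) : ℝ)) * (γ * T ^ (2 / 5 : ℝ)) := by gcongr
      _ = 17 / 5 * γ * (T * T ^ (-(36 / 25) : ℝ) * T ^ (2 / 5 : ℝ)) := by ring
      _ ≤ 17 / 5 * γ * 1 := by gcongr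
      _ = _ := by ring
  have h6 : μ * (17 / 5 * T) * T ^ (-(36 / 25) : ℝ) ≤ γ / 2 := by
    have h7 : 0 < μ * (17 / 5 * T) * T ^ (-(36 / 25) : ℝ) := by positivity
    nlinarith
  calc μ * (T * (1 + x) + α * (1 + x) ^ 2 / (1 - α * (1 + x))) * Real.exp (-t + τ)
      ≤ μ * (17 / 5 * T) * Real.exp (-t + τ) := by gcongr
    _ = μ * (17 / 5 * T) * Real.exp (-t) * Real.exp τ := by rw [Real.exp_add]; ring
    _ ≤ μ * (17 / 5 * T) * T ^ (-(36 / 25) : ℝ) * (7 / 6) := by gcongr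
    _ ≤ γ / 2 * (7 / 6) := by gcongr
    _ = _ := by ring

/-- A choice of the exponent for which the contrast of the other clusters is negligible. -/
lemma exists_exponent {M p γ L n s : ℝ} (hM : 0 < M) (hp : 0 < p) (hp1 : p < 1) (hγ : 0 < γ)
    (hγ1 : γ ≤ 1 / 2) (hL : 0 < L) (hn : 3 * L / p ^ 2 ≤ n) (hs : 0 ≤ s)
    (hs2 : 3.3 * L * M / (γ * p ^ 6) ≤ s ^ 2) :
    ∃ c : ℝ, 0 < c ∧ c ≤ 4 / 5 ∧
      36 / 25 * L ≤ (c * p * p - (c * p) ^ 2 / 2) * (n + s) - M * c ^ 2 := by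
  -- In this scale the hypothesis on s becomes p²s ≥ 1.816·M·q, as 1.816² < 3.3, while γ ≤ 1/2 and p
  -- < 1 give M·q² ≥ 2L.
  set q := Real.sqrt (L / (M * γ)) / p with hq
  have hq0 : 0 < q := by positivity
  have hq2 : q ^ 2 = L / (M * γ * p ^ 2) := by
    rw [hq, div_pow, Real.sq_sqrt (by positivity)]
    field_simp
  have hMq : 2 * L ≤ M * q ^ 2 := by
    rw [hq2]
    have : M * (L / (M * γ * p ^ 2)) = L / (γ * p ^ 2) := by field_simp
    rw [this, le_div_iff₀ (by positivity)]
    have : γ * p ^ 2 ≤ 1 / 2 * 1 := by gcongr; exact pow_le_one₀ hp.le hp1.le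
    nlinarith
  have hs' : 1.816 * M * q ≤ p ^ 2 * s := by
    apply le_of_sq_le_sq _ (by positivity)
    calc (1.816 * M * q) ^ 2 = 1.816 ^ 2 * M ^ 2 * q ^ 2 := by ring
      _ = 1.816 ^ 2 * (p ^ 4 * (L * M / (γ * p ^ 6))) := by
        rw [hq2]; field_simp
      _ ≤ p ^ 4 * (3.3 * L * M / (γ * p ^ 6)) := by
        have : 0 ≤ p ^ 4 * (L * M / (γ * p ^ 6)) := by positivity
        have e : p ^ 4 * (3.3 * L * M / (γ * p ^ 6)) = 3.3 * (p ^ 4 * (L * M / (γ * p ^ 6))) := by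
          ring
        rw [e]
        gcongr
        norm_num
      _ ≤ p ^ 4 * s ^ 2 := by gcongr
      _ = (p ^ 2 * s) ^ 2 := by ring
  have hn' : 3 * L ≤ p ^ 2 * n := by
    rw [div_le_iff₀ (by positivity)] at hn
    linarith
  have hform : ∀ c : ℝ, (c * p * p - (c * p) ^ 2 / 2) * (n + s) - M * c ^ 2 =
      (c - c ^ 2 / 2) * (p ^ 2 * n) + (c - c ^ 2 / 2) * (p ^ 2 * s) - M * c ^ 2 := fun c => by ring
  rcases le_or_gt (4 / 5) (9 / 10 * q) with h | h
  -- At the cap, c - c²/2 = 12/25, so the n-term alone supplies 36L/25. The s-term has to pay for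
  -- M·c² only.
  · refine ⟨4 / 5, by norm_num, le_rfl, ?_⟩
    rw [hform]
    have : M * (4 / 5) ≤ M * (9 / 10 * q) := by gcongr
    norm_num
    nlinarith
  -- Close to 0.908·q, the maximiser of 1.816·q·c - c².
  · refine ⟨9 / 10 * q, by positivity, h.le, ?_⟩
    rw [hform]
    set c := 9 / 10 * q with hc
    have hc0 : 0 < c := by positivity
    have hcc : 0 ≤ c - c ^ 2 / 2 := by nlinarith
    have h1 : (c - c ^ 2 / 2) * (3 * L) ≤ (c - c ^ 2 / 2) * (p ^ 2 * n) := by gcongr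
    have h2 : (c - c ^ 2 / 2) * (1.816 * M * q) ≤ (c - c ^ 2 / 2) * (p ^ 2 * s) := by gcongr
    have h3 : (c - c ^ 2 / 2) * (1.816 * M * q) - M * c ^ 2 =
        M * q ^ 2 * (0.8244 - 0.8172 * c) := by
      rw [hc]; ring
    have h4 : 2 * L * (0.8244 - 0.8172 * c) ≤ M * q ^ 2 * (0.8244 - 0.8172 * c) := by
      gcongr
      linarith
    -- After division by L the difference of the two sides is a concave quadratic in c, positive at
    -- both c = 0 and c = 4/5.
    have h5 : 36 / 25 * L ≤ (c - c ^ 2 / 2) * (3 * L) + 2 * L * (0.8244 - 0.8172 * c) := by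
      have : 0 ≤ (c - c ^ 2 / 2) * 3 + 2 * (0.8244 - 0.8172 * c) - 36 / 25 := by nlinarith
      nlinarith
    linarith

/-! ### Sensitivity outside the tail events -/

lemma binCount_observed {K : ℕ} {Δ : ℝ} (hΔ : 0 < Δ) {ω : Source} {I : Finset ℤ}
    (hfin : ∀ a, size (cluster ω.2 a).2.1 ≠ ∞)
    (hI : ∀ a : ℤ × ℕ, a.1 ∉ I → a.2 < ω.1 a.1 →
      count (Set.Ioc 0 (K * Δ)) (a.1 + (cluster ω.2 a).1) (cluster ω.2 a).2 = 0)
    {e : Event} (he : (e.1.1, e.1.2.1) ∈ born I ω.1) {j : ℕ} (hj : j < K) :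
    binCount Δ (removeCluster (observed (K * Δ) ω) e) j =
        ∑ b ∈ (born I ω.1).erase (e.1.1, e.1.2.1), clusterCount Δ j b.1 (cluster ω.2 b) ∧
      binCount Δ (observed (K * Δ) ω) j =
        ∑ b ∈ (born I ω.1).erase (e.1.1, e.1.2.1), clusterCount Δ j b.1 (cluster ω.2 b) +
        clusterCount Δ j e.1.1 (cluster ω.2 (e.1.1, e.1.2.1)) := by
  classical
  have hB : bin Δ j ⊆ Set.Ioc 0 (K * Δ) := by
    rw [← biUnion_bin hΔ]
    exact Set.subset_biUnion_of_mem (u := bin Δ) (Finset.mem_coe.2 (Finset.mem_range.2 hj))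
  constructor
  · have h := ncard_observed hB hI (fun a => a ≠ (e.1.1, e.1.2.1))
    have hf (p : ℤ × ℕ → Prop) (i : DecidablePred p) (hp : ∀ a, p a ↔ a ≠ (e.1.1, e.1.2.1)) :
        (born I ω.1).filter p = (born I ω.1).erase (e.1.1, e.1.2.1) := by
      ext a
      rw [Finset.mem_filter, Finset.mem_erase, and_comm, hp]
    rw [hf _ _ fun _ => Iff.rfl, ENNReal.toReal_sum fun a _ => count_ne_top (hfin a)] at h
    refine Eq.trans ?_ h
    rw [binCount]
    congr 2
    ext e'
    simp only [removeCluster, SameCluster, bin, Set.mem_Ioc, ne_eq, Prod.mk.injEq]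
    constructor
    · rintro ⟨⟨h1, h2⟩, h3⟩
      exact ⟨h1, fun h4 => h2 ⟨h4.1.symm, h4.2.symm⟩, h3⟩
    · rintro ⟨h1, h2, h3⟩
      exact ⟨⟨h1, fun h4 => h2 ⟨h4.1.symm, h4.2.symm⟩⟩, h3⟩
  · have h := ncard_observed hB hI (fun _ => True)
    rw [Finset.filter_true, ENNReal.toReal_sum fun a _ => count_ne_top (hfin a)] at h
    rw [add_comm, Finset.add_sum_erase _ (fun b => clusterCount Δ j b.1 (cluster ω.2 b)) he]
    refine Eq.trans ?_ h
    rw [binCount]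
    congr 2
    ext e'
    simp [bin]

lemma restContrast_eq (K : ℕ) (Δ : ℝ) (I : Finset ℤ) (ω : Source) (a : ℤ × ℕ) :
    restContrast K Δ I ω a = avgContrast K (fun j => clusterCount Δ j a.1 (cluster ω.2 a))
      (fun j => ∑ b ∈ (born I ω.1).erase a, clusterCount Δ j b.1 (cluster ω.2 b)) := by
  unfold restContrast avgContrast binWeight contrast
  refine Finset.sum_congr rfl fun j _ => ?_
  rw [Finset.sum_sub_distrib, ← Finset.sum_div, Finset.sum_comm]

/-- The tail events involve the full size of a cluster, which dominates its observed number N;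
dividing by the exponents gives the three inequalities that `abs_variance_sub_le` asks for. -/
lemma sensitivity_of_notMem_tailEvent {K : ℕ} {Δ n s θ₀ θ : ℝ} (hK : 2 ≤ K) (hΔ : 0 < Δ)
    (hθ₀ : 0 < θ₀) (hθ : 0 < θ) (hs : 0 ≤ s) {ω : Source} {I : Finset ℤ}
    (hfin : ∀ a, size (cluster ω.2 a).2.1 ≠ ∞)
    (hI : ∀ a : ℤ × ℕ, a.1 ∉ I → a.2 < ω.1 a.1 →
      count (Set.Ioc 0 (K * Δ)) (a.1 + (cluster ω.2 a).1) (cluster ω.2 a).2 = 0)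
    (h₀ : ω ∉ tailEvent K Δ θ₀ 0 (θ₀ * n) I)
    (h₁ : ω ∉ tailEvent K Δ θ θ (θ * (n + s)) I)
    (h₂ : ω ∉ tailEvent K Δ θ (-θ) (θ * (n + s)) I)
    {e : Event} (he : e ∈ observed (K * Δ) ω) :
    |sampleMean K Δ (observed (K * Δ) ω) -
        sampleMean K Δ (removeCluster (observed (K * Δ) ω) e)| ≤ n / K ∧
      |sampleVar K Δ (observed (K * Δ) ω) -
        sampleVar K Δ (removeCluster (observed (K * Δ) ω) e)| ≤
        (n ^ 2 + 2 * n * s * (K / ((K : ℝ) - 1))) / K := by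
  classical
  set a : ℤ × ℕ := (e.1.1, e.1.2.1) with ha
  obtain ⟨hb, ht, h0, hT⟩ := he
  rw [isBorn_iff] at hb
  have hmem : age (cluster ω.2 a).2.2 e.1.2.2 + (a.1 + (cluster ω.2 a).1) ∈
      Set.Ioc 0 (K * Δ) := by
    rw [birthTime_eq] at ht
    rw [add_comm, ← ht]
    exact ⟨h0, hT⟩
  have hc : count (Set.Ioc 0 (K * Δ)) (a.1 + (cluster ω.2 a).1) (cluster ω.2 a).2 ≠ 0 := by
    intro h
    have := ENNReal.tsum_eq_zero.1 h e.1.2.2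
    rw [if_pos ⟨hb.2, by rwa [add_comm]⟩] at this
    exact one_ne_zero this
  have haI : a ∈ born I ω.1 := by
    rw [mem_born]
    refine ⟨?_, hb.1⟩
    by_contra hn
    exact hc (hI a hn hb.1)
  set d : ℕ → ℝ := fun j => clusterCount Δ j a.1 (cluster ω.2 a) with hd
  set R : ℕ → ℝ := fun j =>
    ∑ b ∈ (born I ω.1).erase a, clusterCount Δ j b.1 (cluster ω.2 b) with hR
  have hbin : ∀ j ∈ Finset.range K,
      binCount Δ (removeCluster (observed (K * Δ) ω) e) j = R j ∧
      binCount Δ (observed (K * Δ) ω) j = R j + d j := fun j hj =>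
    binCount_observed hΔ hfin hI haI (Finset.mem_range.1 hj)
  have hm1 : sampleMean K Δ (removeCluster (observed (K * Δ) ω) e) =
      (∑ i ∈ Finset.range K, R i) / K := by
    rw [sampleMean, Finset.sum_congr rfl fun j hj => (hbin j hj).1]
  have hm2 : sampleMean K Δ (observed (K * Δ) ω) =
      (∑ i ∈ Finset.range K, (R i + d i)) / K := by
    rw [sampleMean, Finset.sum_congr rfl fun j hj => (hbin j hj).2]
  set N := ∑ i ∈ Finset.range K, d i with hN
  have hNc : N = (count (Set.Ioc 0 (K * Δ)) (a.1 + (cluster ω.2 a).1) (cluster ω.2 a).2).toReal :=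
    sum_clusterCount hΔ K a.1 (hfin a)
  have hN0 : 0 < N := by
    rw [hNc]
    exact ENNReal.toReal_pos hc (count_ne_top (hfin a))
  have hNle : N ≤ (size (cluster ω.2 a).2.1).toReal := sum_clusterCount_le hΔ K a.1 (hfin a)
  have k0 : (size (cluster ω.2 a).2.1).toReal < n := by
    by_contra! hlt
    exact h₀ ⟨a, haI, hfin a, hc, by rw [zero_mul, add_zero]; gcongr⟩
  have k1 : (size (cluster ω.2 a).2.1).toReal + avgContrast K d R < n + s := by
    by_contra! hlt
    refine h₁ ⟨a, haI, hfin a, hc, ?_⟩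
    rw [restContrast_eq, ← mul_add]
    gcongr
  have k2 : (size (cluster ω.2 a).2.1).toReal - avgContrast K d R < n + s := by
    by_contra! hlt
    refine h₂ ⟨a, haI, hfin a, hc, ?_⟩
    rw [restContrast_eq, neg_mul, ← sub_eq_add_neg, ← mul_sub]
    gcongr
  have hK0 : (0 : ℝ) < K := by
    have : (2 : ℝ) ≤ K := by exact_mod_cast hK
    linarith
  constructor
  · rw [hm1, hm2, Finset.sum_add_distrib, ← sub_div, add_sub_cancel_left,
      abs_of_nonneg (by positivity)]
    gcongr
    linarith
  · have e1 : sampleVar K Δ (observed (K * Δ) ω) =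
        (∑ i ∈ Finset.range K, (R i + d i - (∑ i ∈ Finset.range K, (R i + d i)) / K) ^ 2) /
          ((K : ℝ) - 1) := by
      rw [sampleVar, hm2, Finset.sum_congr rfl fun j hj => by rw [(hbin j hj).2]]
    have e2 : sampleVar K Δ (removeCluster (observed (K * Δ) ω) e) =
        (∑ i ∈ Finset.range K, (R i - (∑ i ∈ Finset.range K, R i) / K) ^ 2) / ((K : ℝ) - 1) := by
      rw [sampleVar, hm1, Finset.sum_congr rfl fun j hj => by rw [(hbin j hj).1]]
    rw [e1, e2]
    exact abs_variance_sub_le hK (fun i => clusterCount_nonneg _ _ _ _) rfl hN0 hs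
      (by linarith) (by linarith) (by linarith)

/-! ### The probability of the exceptional set -/

lemma ae_size_cluster_ne_top {μ α : ℝ} (hα : 0 ≤ α) (hα1 : α < 1) :
    ∀ᵐ ω ∂(sourceLaw μ α), ∀ a, size (cluster ω.2 a).2.1 ≠ ∞ := by
  have hr : α.toNNReal < 1 := by
    rw [← NNReal.coe_lt_coe, Real.coe_toNNReal α hα]
    exact hα1
  rw [ae_all_iff]
  intro a
  have h1 : ∫⁻ η, size (cluster η a).2.1 ∂(clusterSourceLaw α.toNNReal) ≠ ∞ := by
    rw [map_cluster _ a (fun v => size v.2.1) (by fun_prop),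
      (measurePreserving_offspring _).lintegral_comp measurable_size, lintegral_size hr]
    simp
  have h2 : ∀ᵐ η ∂(clusterSourceLaw α.toNNReal), size (cluster η a).2.1 ≠ ∞ := by
    filter_upwards [ae_lt_top (by fun_prop) h1] with η hη using hη.ne
  exact Measure.quasiMeasurePreserving_snd.ae h2

/-- The expected number of observed events is finite, so the first-moment bounds of the blocks form
a convergent series with vanishing tails. -/
lemma tendsto_measure_observed_compl {μ α : ℝ} (hα : 0 ≤ α) (hα1 : α < 1) (T : ℝ) :
    Tendsto (fun I : Finset ℤ => sourceLaw μ α {ω | ∃ a : ℤ × ℕ, a.1 ∈ (I : Set ℤ)ᶜ ∧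
      a.2 < ω.1 a.1 ∧ count (Set.Ioc 0 T) (a.1 + (cluster ω.2 a).1) (cluster ω.2 a).2 ≠ 0})
      atTop (𝓝 0) := by
  have hr : α.toNNReal < 1 := by
    rw [← NNReal.coe_lt_coe, Real.coe_toNNReal α hα]
    exact hα1
  have h1 : ∑' m : ℤ, (μ.toNNReal : ℝ≥0∞) *
      ∫⁻ v, count (Set.Ioc 0 T) (m + v.1) v.2 ∂(clusterLaw α.toNNReal) ≠ ∞ := by
    have := tsum_lintegral_count α.toNNReal (measurableSet_Ioc (a := (0 : ℝ)) (b := T))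
      (h := fun _ => 1) measurable_const
    simp only [mul_one] at this
    rw [ENNReal.tsum_mul_left, this, lintegral_size hr, Real.volume_Ioc]
    exact ENNReal.mul_ne_top (by simp) (ENNReal.mul_ne_top (by simp) (by simp))
  have h2 := ENNReal.tendsto_tsum_compl_atTop_zero h1
  refine tendsto_of_tendsto_of_tendsto_of_le_of_le tendsto_const_nhds h2 (fun _ => zero_le)
    fun I => ?_
  exact measure_count_ne_zero_le μ α measurableSet_Ioc _

/-- Outside a set of probability `2 * γ`, the sample moments have the sensitivities on which the
noise scales are based. -/
theorem measure_sensitivity_le {μ α γ Δ n s : ℝ} {K : ℕ} (hμ : 0 < μ) (hα : 0 < α) (hα1 : α < 1)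
    (hγ : 0 < γ) (hγ_le : γ ≤ 1 / 2) (hK : 2 ≤ K) (hΔ : 10 * (α ^ 2 / (2 * (1 - α))) < Δ)
    (hT_one : 1 < (K : ℝ) * Δ) (hT : (μ * Real.exp 2 / γ) ^ (5 / 2 : ℝ) ≤ (K : ℝ) * Δ)
    (hn : 3 * Real.log (K * Δ) / (1 - α) ^ 2 ≤ n) (hs : 0 ≤ s)
    (hs2 : 3.3 * Real.log (K * Δ) * (μ * Δ * (1 - α)) / (γ * (1 - α) ^ 6) ≤ s ^ 2) :
    sourceLaw μ α {ω | ¬ ∀ e ∈ observed (K * Δ) ω,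
      |sampleMean K Δ (observed (K * Δ) ω) -
          sampleMean K Δ (removeCluster (observed (K * Δ) ω) e)| ≤ n / K ∧
        |sampleVar K Δ (observed (K * Δ) ω) -
          sampleVar K Δ (removeCluster (observed (K * Δ) ω) e)| ≤
          (n ^ 2 + 2 * n * s * (K / ((K : ℝ) - 1))) / K} ≤ ENNReal.ofReal (2 * γ) := by
  have hp : 0 < 1 - α := by linarith
  have hΔ0 : 0 < Δ := lt_of_le_of_lt (by positivity) hΔ
  have hK2 : (2 : ℝ) ≤ K := by exact_mod_cast hK
  have hTα : 10 * α ^ 2 / (1 - α) < K * Δ := by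
    have e : 10 * α ^ 2 / (1 - α) = 2 * (10 * (α ^ 2 / (2 * (1 - α)))) := by field_simp
    rw [e]
    nlinarith
  have hL : 0 < Real.log (K * Δ) := Real.log_pos hT_one
  -- The factor 7/6 pays for the slack of the finite set `I`. Three tail events at 7γ/12 and γ/4 for
  -- the blocks outside `I` add up to 2γ.
  obtain ⟨ε, hε, hε1⟩ : ∃ ε : ℝ, 0 < ε ∧ Real.exp (μ * ε) ≤ 7 / 6 := by
    refine ⟨Real.log (7 / 6) / μ, div_pos (Real.log_pos (by norm_num)) hμ, ?_⟩
    rw [mul_div_cancel₀ _ hμ.ne', Real.exp_log (by norm_num)]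
  have hxα : ∀ x, x ≤ 4 / 5 * (1 - α) → α * (1 + x) < 1 := fun x hx => by nlinarith
  -- the event that a cluster is large
  set x₀ : ℝ := 4 / 5 * (1 - α) with hx₀
  set θ₀ : ℝ := x₀ * (1 - α) - x₀ ^ 2 / 2 with hθ₀
  -- Combined with n ≥ 3 log T/(1-α)² this gives the exponent 36/25 of `tail_numeric`.
  have hθ₀e : θ₀ = 12 / 25 * (1 - α) ^ 2 := by rw [hθ₀, hx₀]; ring
  have hθ₀0 : 0 < θ₀ := by rw [hθ₀e]; positivity
  have t₀ : ∀ᶠ I : Finset ℤ in atTop, sourceLaw μ α (tailEvent K Δ θ₀ 0 (θ₀ * n) I) ≤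
      ENNReal.ofReal (7 / 12 * γ) := by
    have hx₀0 : 0 ≤ x₀ := by positivity
    have hm := (exponential_moments hα hα1 hx₀0 (by linarith : 0 ≤ (K : ℝ) * Δ)
      (hxα _ le_rfl)).2
    have := eventually_measure_tailEvent_le (κ := 0) (ρ := 0) (t := θ₀ * n) hα.le hα1 hΔ0 hK
      le_rfl (by simp [expWeight]) hm hμ.le hε
    filter_upwards [this] with I hI
    refine hI.trans (ENNReal.ofReal_le_ofReal ?_)
    have := tail_numeric hμ hα hα1 hγ hx₀0 le_rfl hT_one hTα hT (t := θ₀ * n) ?_ hε1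
    · convert this using 3
      ring
    · rw [hθ₀e]
      rw [div_le_iff₀ (by positivity)] at hn
      linarith
  -- the events that the other clusters have a large contrast
  obtain ⟨c, hc0, hc1, hc⟩ := exists_exponent (by positivity : 0 < μ * Δ * (1 - α)) hp
    (by linarith) hγ hγ_le hL hn hs hs2
  set x : ℝ := c * (1 - α) with hx
  set θ : ℝ := x * (1 - α) - x ^ 2 / 2 with hθ
  have hx0 : 0 < x := by positivity
  have hx1 : x ≤ 4 / 5 * (1 - α) := by rw [hx]; gcongr
  have hθ0 : 0 < θ := by
    have : θ = x * ((1 - α) - x / 2) := by rw [hθ]; ring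
    rw [this]
    exact mul_pos hx0 (by linarith)
  obtain ⟨m1, m2⟩ := exponential_moments hα hα1 hx0.le (by linarith : 0 ≤ (K : ℝ) * Δ)
      (hxα _ hx1)
  have t₁ : ∀ κ : ℝ, |κ| = θ → ∀ᶠ I : Finset ℤ in atTop,
      sourceLaw μ α (tailEvent K Δ θ κ (θ * (n + s)) I) ≤ ENNReal.ofReal (7 / 12 * γ) := by
    intro κ hκ
    have := eventually_measure_tailEvent_le (κ := κ) (ρ := x ^ 2 / (2 * (1 - α)))
      (t := θ * (n + s)) hα.le hα1 hΔ0 hK (by positivity) (by rw [hκ]; exact m1) m2 hμ.le hε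
    filter_upwards [this] with I hI
    refine hI.trans (ENNReal.ofReal_le_ofReal ?_)
    -- The contrast term 2μΔρ equals μΔ(1-α)c² for x = c(1-α). It is subtracted from the threshold,
    -- and the choice of c keeps the result above 36/25·log T.
    have := tail_numeric hμ hα hα1 hγ hx0.le hx1 hT_one hTα hT
      (t := θ * (n + s) - μ * Δ * (1 - α) * c ^ 2) hc hε1
    convert this using 3
    rw [hx]
    field_simp
    ring
  have t₂ : ∀ᶠ I : Finset ℤ in atTop, sourceLaw μ α {ω | ∃ a : ℤ × ℕ, a.1 ∈ (I : Set ℤ)ᶜ ∧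
      a.2 < ω.1 a.1 ∧ count (Set.Ioc 0 (K * Δ)) (a.1 + (cluster ω.2 a).1) (cluster ω.2 a).2 ≠ 0} ≤
      ENNReal.ofReal (1 / 4 * γ) := by
    have h0 : (0 : ℝ≥0∞) < ENNReal.ofReal (1 / 4 * γ) := by
      rw [ENNReal.ofReal_pos]; positivity
    filter_upwards [(tendsto_measure_observed_compl hα.le hα1 (K * Δ)).eventually_lt_const h0]
      with I hI using hI.le
  obtain ⟨I, e0, e1, e2, e3⟩ := (t₀.and ((t₁ θ (abs_of_pos hθ0)).and
    ((t₁ (-θ) (by rw [abs_neg, abs_of_pos hθ0])).and t₂))).exists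
  have hnull := ae_iff.1 (ae_size_cluster_ne_top (μ := μ) hα.le hα1)
  refine le_trans (measure_mono (t := ((({ω | ¬ ∀ a, size (cluster ω.2 a).2.1 ≠ ∞} ∪
    tailEvent K Δ θ₀ 0 (θ₀ * n) I) ∪ tailEvent K Δ θ θ (θ * (n + s)) I) ∪
    tailEvent K Δ θ (-θ) (θ * (n + s)) I) ∪ {ω | ∃ a : ℤ × ℕ, a.1 ∈ (I : Set ℤ)ᶜ ∧
      a.2 < ω.1 a.1 ∧ count (Set.Ioc 0 (K * Δ)) (a.1 + (cluster ω.2 a).1) (cluster ω.2 a).2 ≠ 0})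
    ?_) ?_
  · intro ω hω
    by_contra hn'
    simp only [Set.mem_union, not_or] at hn'
    obtain ⟨⟨⟨⟨n1, n2⟩, n3⟩, n4⟩, n5⟩ := hn'
    refine hω fun e he => sensitivity_of_notMem_tailEvent hK hΔ0 hθ₀0 hθ0 hs (not_not.1 n1) ?_
      n2 n3 n4 he
    intro a ha1 ha2
    by_contra hne
    exact n5 ⟨a, by simpa using ha1, ha2, hne⟩
  · refine (measure_union_le _ _).trans ((add_le_add ((measure_union_le _ _).trans
      (add_le_add ((measure_union_le _ _).trans (add_le_add ((measure_union_le _ _).trans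
      (add_le_add hnull.le e0)) e1)) e2)) e3).trans ?_)
    rw [zero_add, ← ENNReal.ofReal_add (by positivity) (by positivity),
      ← ENNReal.ofReal_add (by positivity) (by positivity),
      ← ENNReal.ofReal_add (by positivity) (by positivity)]
    exact ENNReal.ofReal_le_ofReal (by linarith)

end HawkesDP

end

/-! ### Privacy of the three mechanisms from the sensitivity bounds. -/

theorem mainTheorem5
    (μ μup α αup γ ε Δ : ℝ) (K : ℕ)
    (hμ : 0 < μ) (hμup : μ ≤ μup)
    (hα : 0 < α) (hαup : α ≤ αup) (hαup_lt : αup < 1)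
    (hγ : 0 < γ) (hγ_le : γ ≤ 1 / 2) (hε : 0 < ε)
    (hK : 2 ≤ K)
    (hΔ : 10 * (α ^ 2 / (2 * (1 - α))) < Δ)
    (hT_one : 1 < (K : ℝ) * Δ)
    (hT : (μ * Real.exp 2 / γ) ^ (5 / 2 : ℝ) ≤ (K : ℝ) * Δ) :
    HawkesDP.IsRandomlyDP (HawkesDP.sourceLaw μ α) (HawkesDP.observed ((K : ℝ) * Δ))
      (HawkesDP.privateMean αup ε K Δ) (2 * γ) ε ∧
    HawkesDP.IsRandomlyDP (HawkesDP.sourceLaw μ α) (HawkesDP.observed ((K : ℝ) * Δ))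
      (HawkesDP.privateVar μup αup γ ε K Δ) (2 * γ) ε ∧
    ∀ solve : ℝ × ℝ → ℝ × ℝ, Measurable solve → HawkesDP.SolvesMomentEquations Δ solve →
      HawkesDP.IsRandomlyDP (HawkesDP.sourceLaw μ α) (HawkesDP.observed ((K : ℝ) * Δ))
        (HawkesDP.privateEstimates μup αup γ ε K Δ solve) (2 * γ) (2 * ε) := by
  have hα1 : α < 1 := lt_of_le_of_lt hαup hαup_lt
  have hp : 0 < 1 - α := by linarith
  have hpup : 0 < 1 - αup := by linarith
  have hppup : 1 - αup ≤ 1 - α := by linarith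
  have hμup0 : 0 < μup := lt_of_lt_of_le hμ hμup
  have hΔ0 : 0 < Δ := lt_of_le_of_lt (by positivity) hΔ
  have hK2 : (2 : ℝ) ≤ K := by exact_mod_cast hK
  have hK1 : (0 : ℝ) < K - 1 := by linarith
  have hL : 0 < Real.log (K * Δ) := Real.log_pos hT_one
  have hC₂ : 0 < HawkesDP.C₂ αup := by unfold HawkesDP.C₂; positivity
  have hC₁ : 0 < HawkesDP.C₁ μup αup γ := Real.sqrt_pos.2 (by positivity)
  set n : ℝ := HawkesDP.C₂ αup * Real.log (K * Δ) with hn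
  set s : ℝ := Real.sqrt n * HawkesDP.C₁ μup αup γ * Real.sqrt Δ with hs
  have hn0 : 0 < n := mul_pos hC₂ hL
  have hs0 : 0 < s := by positivity
  have hn1 : 3 * Real.log (K * Δ) / (1 - α) ^ 2 ≤ n := by
    rw [hn, HawkesDP.C₂, div_mul_eq_mul_div]
    gcongr
  -- The constant is 3·1.1, from C₂ and C₁²; both increase when μ and α are replaced by their upper
  -- bounds.
  have hs2 : 3.3 * Real.log (K * Δ) * (μ * Δ * (1 - α)) / (γ * (1 - α) ^ 6) ≤ s ^ 2 := by
    have h1 : s ^ 2 = n * (1.1 * μup / (1 - αup) ^ 3 * (1 / γ)) * Δ := by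
      rw [hs, mul_pow, mul_pow, Real.sq_sqrt hn0.le, Real.sq_sqrt hΔ0.le, HawkesDP.C₁,
        Real.sq_sqrt (by positivity)]
    have h2 : 3.3 * Real.log (K * Δ) * (μ * Δ * (1 - α)) / (γ * (1 - α) ^ 6) =
        3 * Real.log (K * Δ) / (1 - α) ^ 2 * (1.1 * μ / (1 - α) ^ 3 * (1 / γ)) * Δ := by
      field_simp
      ring
    rw [h1, h2]
    gcongr
  have key := HawkesDP.measure_sensitivity_le hμ hα hα1 hγ hγ_le hK hΔ hT_one hT hn1 hs0.le hs2
  have hb1 : 0 < HawkesDP.meanScale αup ε K (K * Δ) := by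
    unfold HawkesDP.meanScale; positivity
  have hb1' : HawkesDP.meanScale αup ε K (K * Δ) * ε = n / K := by
    rw [HawkesDP.meanScale, ← hn]
    field_simp
  have hb2' : HawkesDP.varScale μup αup γ ε K Δ (K * Δ) * ε =
      (n ^ 2 + 2 * n * s * (K / ((K : ℝ) - 1))) / K := by
    -- The powers 3/2 in the noise scale are n·√n: one factor n from the sensitivity and √n from s.
    have h1 : HawkesDP.C₂ αup ^ (3 / 2 : ℝ) * Real.log (K * Δ) ^ (3 / 2 : ℝ) =
        n * Real.sqrt n := by
      rw [← Real.mul_rpow hC₂.le hL.le, ← hn, Real.sqrt_eq_rpow, show (3 / 2 : ℝ) = 1 + 1 / 2 by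
        norm_num, Real.rpow_add hn0, Real.rpow_one]
    have h2 : 2 * HawkesDP.C₂ αup ^ (3 / 2 : ℝ) * HawkesDP.C₁ μup αup γ * ((K : ℝ) / (K - 1)) *
        Real.log (K * Δ) ^ (3 / 2 : ℝ) * Real.sqrt Δ = 2 * n * s * (K / ((K : ℝ) - 1)) := by
      rw [hs]
      linear_combination (2 * HawkesDP.C₁ μup αup γ * ((K : ℝ) / (K - 1)) * Real.sqrt Δ) * h1
    rw [HawkesDP.varScale, h2, ← mul_pow, ← hn]
    field_simp
  have hb2 : 0 < HawkesDP.varScale μup αup γ ε K Δ (K * Δ) := by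
    refine pos_of_mul_pos_left (b := ε) ?_ hε.le
    rw [hb2']
    positivity
  have hmean : ∀ S S' : Set HawkesDP.Event,
      |HawkesDP.sampleMean K Δ S - HawkesDP.sampleMean K Δ S'| ≤ n / K →
      HawkesDP.Indistinguishable ε (HawkesDP.privateMean αup ε K Δ S)
        (HawkesDP.privateMean αup ε K Δ S') := fun S S' h =>
    HawkesDP.indistinguishable_laplace hb1 (by rwa [hb1'])
  have hvar : ∀ S S' : Set HawkesDP.Event,
      |HawkesDP.sampleVar K Δ S - HawkesDP.sampleVar K Δ S'| ≤
        (n ^ 2 + 2 * n * s * (K / ((K : ℝ) - 1))) / K →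
      HawkesDP.Indistinguishable ε (HawkesDP.privateVar μup αup γ ε K Δ S)
        (HawkesDP.privateVar μup αup γ ε K Δ S') := fun S S' h =>
    HawkesDP.indistinguishable_laplace hb2 (by rwa [hb2'])
  -- All three claims use one exceptional set, the one of `measure_sensitivity_le`, so the joint
  -- output pays 2γ only once.
  have sub : ∀ P : Set HawkesDP.Event → HawkesDP.Event → Prop,
      (∀ ω e, |HawkesDP.sampleMean K Δ (HawkesDP.observed (K * Δ) ω) -
          HawkesDP.sampleMean K Δ
            (HawkesDP.removeCluster (HawkesDP.observed (K * Δ) ω) e)| ≤ n / K →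
        |HawkesDP.sampleVar K Δ (HawkesDP.observed (K * Δ) ω) -
          HawkesDP.sampleVar K Δ (HawkesDP.removeCluster (HawkesDP.observed (K * Δ) ω) e)| ≤
          (n ^ 2 + 2 * n * s * (K / ((K : ℝ) - 1))) / K →
        P (HawkesDP.observed (K * Δ) ω) e) →
      HawkesDP.sourceLaw μ α {ω | ¬ ∀ e ∈ HawkesDP.observed (K * Δ) ω,
        P (HawkesDP.observed (K * Δ) ω) e} ≤ ENNReal.ofReal (2 * γ) := by
    intro P hP
    refine (measure_mono ?_).trans key
    intro ω hω hgood
    exact hω fun e he => hP ω e (hgood e he).1 (hgood e he).2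
  refine ⟨sub (fun S e => HawkesDP.Indistinguishable ε (HawkesDP.privateMean αup ε K Δ S)
      (HawkesDP.privateMean αup ε K Δ (HawkesDP.removeCluster S e))) fun ω e h1 _ => hmean _ _ h1,
    sub (fun S e => HawkesDP.Indistinguishable ε (HawkesDP.privateVar μup αup γ ε K Δ S)
      (HawkesDP.privateVar μup αup γ ε K Δ (HawkesDP.removeCluster S e)))
      fun ω e _ h2 => hvar _ _ h2,
    fun solve hsolve _ => sub (fun S e => HawkesDP.Indistinguishable (2 * ε)
      (HawkesDP.privateEstimates μup αup γ ε K Δ solve S)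
      (HawkesDP.privateEstimates μup αup γ ε K Δ solve (HawkesDP.removeCluster S e)))
      fun ω e h1 h2 => ?_⟩
  have : ∀ S, SFinite (HawkesDP.privateMean αup ε K Δ S) := fun S => by
    unfold HawkesDP.privateMean; infer_instance
  have : ∀ S, SFinite (HawkesDP.privateVar μup αup γ ε K Δ S) := fun S => by
    unfold HawkesDP.privateVar; infer_instance
  rw [two_mul ε]
  exact (hmean _ _ h1).prod_map (hvar _ _ h2) hsolve
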